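/- For integers $d,\ell\ge 1$ and a real $p\ge 1$, define the $p$-Wasserstein distance of $S=(S_1,\dots,S_\ell)$ and $T=(T_1,\dots,T_\ell)$ in $(\mathbb{R}^d)^\ell$ by $$d^{(p)}_{\mathrm{WS}}(S,T)=\min_{\pi}\Big(\sum_{i=1}^{\ell}\|S_i-T_{\pi(i)}\|_2^{\,p}\Big)^{1/p},$$ where $\pi$ ranges over the permutations of $\{1,\dots,\ell\}$. For a finite set $\mathcal{S}\subseteq(\mathbb{R}^d)^\ell$ with weights $w:\mathcal{S}\to\mathbb{R}_{\ge 0}$ (unit weights if none are given) and $s\in(\mathbb{R}^d)^\ell$, let $\mathrm{cost}^{(p)}_{\mathrm{WS}}(\mathcal{S},s)=\sum_{S\in\mathcal{S}}w(S)\,d^{(p)}_{\mathrm{WS}}(S,s)$. A weighted subset $\mathcal{S}\subseteq\mathcal{P}$ is an $(\epsilon,A)$-coreset of $\mathcal{P}$ for $p$-Wasserstein barycenter if for all $s\in(\mathbb{R}^d)^\ell$ $$\big|\mathrm{cost}^{(p)}_{\mathrm{WS}}(\mathcal{P},s)-\mathrm{cost}^{(p)}_{\mathrm{WS}}(\mathcal{S},s)\big|\le\epsilon\,\big(\mathrm{cost}^{(p)}_{\mathrm{WS}}(\mathcal{P},s)+A\big).$$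 **Theorem.** There are one randomized algorithm and constants $C,k$ such that the following holds. Let $d,\ell\ge 1$ be integers, $p\ge 1$, $0<\epsilon<1$, $0<\delta<1$, let $\mathcal{P}\subseteq(\mathbb{R}^d)^\ell$ be finite and non-empty, and let $c\in(\mathbb{R}^d)^\ell$. Given these, the algorithm computes a weighted subset $\mathcal{S}\subseteq\mathcal{P}$ such that 1. the size of $\mathcal{S}$ is always at most $C\,f\,(1+\log f)^k\cdot(1+\log\frac1\delta)$ with $f=\epsilon^{-2}d\ell$; that is, it is $\tilde O(\epsilon^{-2}d\ell)$ for fixed $\delta$, and independent of $p$; 2. with probability at least $1-\delta$, $\mathcal{S}$ is an $(\epsilon,\mathrm{cost}^{(p)}_{\mathrm{WS}}(\mathcal{P},c))$-coreset of $\mathcal{P}$ for $p$-Wasserstein barycenter; 3. the running time is always at most $C\,g\,(1+\log g)^k$ with $g=|\mathcal{P}|\cdot T_{\mathrm{dist}}$; that is, it is $\tilde O(|\mathcal{P}|\cdot T_{\mathrm{dist}})$, where the integer $T_{\mathrm{dist}}\ge 1$ is the time of one evaluation of $d^{(p)}_{\mathrm{WS}}$ between two of the points in $\mathcal{P}\cup\{c\}$.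 The algorithm is a program of a randomized real RAM with unit-cost operations: addition and truncated subtraction of natural numbers; addition, subtraction, multiplication and division of reals (with $x/0=0$); comparisons; conversion of a natural number to a real; indexed memory access; and drawing a uniformly random element of $\{0,\dots,m-1\}$. It accesses the points only through evaluations of $d^{(p)}_{\mathrm{WS}}$, each costing $T_{\mathrm{dist}}$. -/

import Mathlib

noncomputable section

namespace Barycenter

/-! ### Wasserstein distance and additive-error coresets -/

/-- The `p`-Wasserstein distance between two `ℓ`-tuples of points of a metric space: the minimum over
all bijections of the `ℓ^p`-aggregated matching distances. -/
def dWS {X : Type*} [MetricSpace X] {ℓ : ℕ} (p : ℝ) (S T : Fin ℓ → X) : ℝ :=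
  Finset.univ.inf' ⟨1, Finset.mem_univ _⟩
    (fun π : Equiv.Perm (Fin ℓ) => (∑ i, dist (S i) (T (π i)) ^ p) ^ (1 / p))

/-- The barycenter (1-median) objective of a weighted finite set `(S, w)` at the center `s`. -/
def costWS {X : Type*} [MetricSpace X] {ℓ : ℕ} (p : ℝ) (S : Finset (Fin ℓ → X))
    (w : (Fin ℓ → X) → ℝ) (s : Fin ℓ → X) : ℝ :=
  ∑ x ∈ S, w x * dWS p x s

/-- `(S, w)` is a weighted subset of `P`. -/
def IsWeightedSubset {Y : Type*} (P S : Finset Y) (w : Y → ℝ) : Prop :=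
  S ⊆ P ∧ ∀ x ∈ S, 0 ≤ w x

/-- `(S, w)` is an `(ε, A)`-coreset of the (unit weight) set `P` for the `p`-Wasserstein
barycenter problem. -/
def IsCoreset {X : Type*} [MetricSpace X] {ℓ : ℕ} (p ε A : ℝ) (P S : Finset (Fin ℓ → X))
    (w : (Fin ℓ → X) → ℝ) : Prop :=
  IsWeightedSubset P S w ∧
    ∀ s : Fin ℓ → X,
      |costWS p P (fun _ => 1) s - costWS p S w s| ≤ ε * (costWS p P (fun _ => 1) s + A)

/-! ### A randomized real RAM with a distance oracle

Memory consists of arrays of natural numbers and arrays of real numbers; a scalar variable is an array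
of which only cell `0` is used. Programs are finite first-order objects whose only constants are
natural numbers. Control flow is restricted to branching and to loops whose number of iterations is
fixed on entry, so every program halts. There is no conversion from reals to naturals and no
multiplication of naturals. -/

/-- Memory contents, together with the clock (which programs can not read). -/
structure State where
  nat : ℕ → ℕ → ℕ
  real : ℕ → ℕ → ℝ
  time : ℕ

/-- Expressions with values in the natural numbers. -/
inductive NExpr where
  | lit (k : ℕ)
  | get (a : ℕ) (i : NExpr)
  | add (e f : NExpr)
  | sub (e f : NExpr)

/-- Expressions with values in the real numbers. -/
inductive RExpr where
  | ofNat (e : NExpr)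
  | get (a : ℕ) (i : NExpr)
  | add (e f : RExpr)
  | sub (e f : RExpr)
  | mul (e f : RExpr)
  | div (e f : RExpr)

/-- Tests for branching. -/
inductive Test where
  | nle (e f : NExpr)
  | rle (e f : RExpr)

/-- Programs. Each of `setN`, `setR`, `dist`, `rand` writes cell `i` of array `a`: the value of `e`,
the distance between the points with indices `e` and `f`, or a uniformly random element
of `{0, …, e - 1}`. -/
inductive Prog where
  | skip
  | setN (a : ℕ) (i e : NExpr)
  | setR (a : ℕ) (i : NExpr) (e : RExpr)
  | dist (a : ℕ) (i e f : NExpr)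
  | rand (a : ℕ) (i e : NExpr)
  | seq (A B : Prog)
  | ite (t : Test) (A B : Prog)
  | loop (e : NExpr) (A : Prog)

def NExpr.eval (σ : State) : NExpr → ℕ
  | lit k => k
  | get a i => σ.nat a (i.eval σ)
  | add e f => e.eval σ + f.eval σ
  | sub e f => e.eval σ - f.eval σ

def RExpr.eval (σ : State) : RExpr → ℝ
  | ofNat e => (e.eval σ : ℝ)
  | get a i => σ.real a (i.eval σ)
  | add e f => e.eval σ + f.eval σ
  | sub e f => e.eval σ - f.eval σ
  | mul e f => e.eval σ * f.eval σ
  | div e f => e.eval σ / f.eval σ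

def Test.holds (σ : State) : Test → Prop
  | nle e f => e.eval σ ≤ f.eval σ
  | rle e f => e.eval σ ≤ f.eval σ

/-- The time to evaluate an expression: one step for every node. -/
def NExpr.cost : NExpr → ℕ
  | lit _ => 1
  | get _ i => i.cost + 1
  | add e f => e.cost + f.cost + 1
  | sub e f => e.cost + f.cost + 1

def RExpr.cost : RExpr → ℕ
  | ofNat e => e.cost + 1
  | get _ i => i.cost + 1
  | add e f => e.cost + f.cost + 1
  | sub e f => e.cost + f.cost + 1
  | mul e f => e.cost + f.cost + 1
  | div e f => e.cost + f.cost + 1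

def Test.cost : Test → ℕ
  | nle e f => e.cost + f.cost + 1
  | rle e f => e.cost + f.cost + 1

def State.tick (σ : State) (t : ℕ) : State := { σ with time := σ.time + t }

def State.putN (σ : State) (a i v : ℕ) : State :=
  { σ with nat := fun b j => if b = a ∧ j = i then v else σ.nat b j }

def State.putR (σ : State) (a i : ℕ) (v : ℝ) : State :=
  { σ with real := fun b j => if b = a ∧ j = i then v else σ.real b j }

/-- A uniformly random element of `{0, …, m - 1}` (and `0` if `m = 0`). -/
def uniformBelow : ℕ → PMF ℕ
  | 0 => PMF.pure 0
  | m + 1 => (PMF.uniformOfFintype (Fin (m + 1))).map Fin.val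

/-- Run `f` a given number of times, each iteration taking one additional step. -/
def iterate (f : State → PMF State) : ℕ → State → PMF State
  | 0, σ => PMF.pure σ
  | m + 1, σ => (f (σ.tick 1)).bind (iterate f m)

open Classical in
/-- The distribution of the final state of a program. `D` is the distance oracle, each call of which
takes `T` steps; every other operation takes one step. -/
def Prog.run (D : ℕ → ℕ → ℝ) (T : ℕ) : Prog → State → PMF State
  | skip, σ => PMF.pure (σ.tick 1)
  | setN a i e, σ =>
      PMF.pure ((σ.putN a (i.eval σ) (e.eval σ)).tick (i.cost + e.cost + 1))
  | setR a i e, σ =>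
      PMF.pure ((σ.putR a (i.eval σ) (e.eval σ)).tick (i.cost + e.cost + 1))
  | dist a i e f, σ =>
      PMF.pure ((σ.putR a (i.eval σ) (D (e.eval σ) (f.eval σ))).tick
        (i.cost + e.cost + f.cost + T + 1))
  | rand a i e, σ =>
      (uniformBelow (e.eval σ)).map
        (fun v => (σ.putN a (i.eval σ) v).tick (i.cost + e.cost + 1))
  | seq A B, σ => (A.run D T σ).bind (B.run D T)
  | ite t A B, σ =>
      if t.holds σ then A.run D T (σ.tick (t.cost + 1)) else B.run D T (σ.tick (t.cost + 1))
  | loop e A, σ => iterate (A.run D T) (e.eval σ) (σ.tick (e.cost + 1))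

/-! ### Input and output of a coreset algorithm -/

/-- The initial state: `n, d, ℓ` in cells `0, 1, 2` of the natural array `0`, the numbers `p, ε, δ`
in cells `0, 1, 2` of the real array `0`, and zeros elsewhere. -/
def input (n d ℓ : ℕ) (p ε δ : ℝ) : State where
  nat := fun a i => if a = 0 then (if i = 0 then n else if i = 1 then d else if i = 2 then ℓ else 0)
    else 0
  real := fun a i =>
    if a = 0 then (if i = 0 then p else if i = 1 then ε else if i = 2 then δ else 0) else 0
  time := 0

/-- The distance oracle of the data set `P`, enumerated by `pt`: the indices `i < |P|` stand for the
data points, all other indices for the center `c`. -/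
def oracle {X : Type*} [MetricSpace X] {ℓ : ℕ} (p : ℝ) (P : Finset (Fin ℓ → X))
    (pt : Fin P.card ≃ P) (c : Fin ℓ → X) (i j : ℕ) : ℝ :=
  let node : ℕ → (Fin ℓ → X) := fun m => if h : m < P.card then (pt ⟨m, h⟩ : Fin ℓ → X) else c
  dWS p (node i) (node j)

open Classical in
/-- The weight of a data point in the output: cell `i` of the real array `1` is the weight of the data
point with index `i`. -/
def outWeight {Y : Type*} {P : Finset Y} (pt : Fin P.card ≃ P) (σ : State) (x : Y) : ℝ :=
  if h : x ∈ P then σ.real 1 (pt.symm ⟨x, h⟩) else 0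

open Classical in
/-- The output set: the data points of nonzero weight. -/
def outSet {Y : Type*} {P : Finset Y} (pt : Fin P.card ≃ P) (σ : State) : Finset Y :=
  P.filter (fun x => outWeight pt σ x ≠ 0)

/-- The bound `C · f · polylog(f)`, with polylogarithmic factor `(1 + log f)^k`, for `f ≥ 1`;
`Õ(f)` means such a bound with universal `C` and `k`. -/
def softBound (C : ℝ) (k : ℕ) (f : ℝ) : ℝ :=
  C * f * (1 + Real.log f) ^ k

end Barycenter

end

noncomputable section
namespace Barycenter

/-! ### The Wasserstein distance is a pseudometric -/

section Wasserstein

variable {X : Type*} [MetricSpace X] {ℓ : ℕ} {p : ℝ}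

/-! The algorithm is importance sampling relative to the approximate center c. Let n = |P|, a(x) =
d(x, c) and A = cost(P, c). For every s write d(x, s) = d(c, s) + excess, where |excess| ≤ a(x)
whatever s is (`abs_excess_le`). Hence cost(P, s) is known once the number n and the total excess
are estimated, and the terms of these two sums are dominated by 1 and a(x), which do not depend on
s.

Each point x receives about n·a(x)/A slots, rounded up and at least one, which makes at most 2n
slots in total (`SlotInvariant.total_le`). Drawing one of the M slots uniformly and adding
M/(m·k(x)) to the weight of its owner x, where k(x) is the number of slots of x, gives an unbiased
estimate. One draw contributes at most 2A/m to the excess and 2n/m to the count, so Hoeffding's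
inequality (`sampling_tail`) keeps the excess at a fixed s within εA/4 of its true value, except
with probability 2·exp(-mε²/512).

It remains to treat all s at once. If d(c, s) ≥ 6A/(εn), the true and the estimated excess together
are at most 3A, which is within the allowed error. All other s lie, after reordering of the tuple,
in a ball of a normed space of dimension dℓ, where a net of (289/ε²)^(dℓ) points suffices
(`exists_dWS_net`, `isCoreset_of_net`). The union bound over the net needs m of order ε⁻²(dℓ·(1 +
log(1/ε)) + log(1/δ)) (`failure_le`); the exponent p never enters. If m reaches n, all points are
output instead.

Statements about the program that hold with certainty, including its running time, are Hoare triples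
(`Triple`); exponential moments pass through the sampling loop by `expect_iterate_le`. -/

theorem dWS_nonneg (S T : Fin ℓ → X) : 0 ≤ dWS p S T := by
  unfold dWS
  refine Finset.le_inf' _ _ fun π _ => ?_
  exact Real.rpow_nonneg (Finset.sum_nonneg fun i _ => Real.rpow_nonneg dist_nonneg _) _

/-- In this form Minkowski's inequality comes for free, as the triangle inequality of `PiLp`. -/
theorem dWS_eq_inf'_dist (hp : 1 ≤ p) [Fact (1 ≤ ENNReal.ofReal p)] (S T : Fin ℓ → X) :
    dWS p S T = Finset.univ.inf' ⟨1, Finset.mem_univ _⟩ (fun π : Equiv.Perm (Fin ℓ) =>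
      dist (WithLp.toLp (ENNReal.ofReal p) S) (WithLp.toLp (ENNReal.ofReal p) (T ∘ π))) := by
  have h : (ENNReal.ofReal p).toReal = p := ENNReal.toReal_ofReal (by linarith)
  unfold dWS
  congr 1
  funext π
  rw [PiLp.dist_eq_sum (by rw [h]; linarith), h]
  rfl

theorem dWS_le_dist (hp : 1 ≤ p) [Fact (1 ≤ ENNReal.ofReal p)] (S T : Fin ℓ → X)
    (π : Equiv.Perm (Fin ℓ)) :
    dWS p S T ≤
      dist (WithLp.toLp (ENNReal.ofReal p) S) (WithLp.toLp (ENNReal.ofReal p) (T ∘ π)) := by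
  rw [dWS_eq_inf'_dist hp]
  exact Finset.inf'_le _ (Finset.mem_univ π)

theorem exists_dWS_eq_dist (hp : 1 ≤ p) [Fact (1 ≤ ENNReal.ofReal p)] (S T : Fin ℓ → X) :
    ∃ π : Equiv.Perm (Fin ℓ), dWS p S T =
      dist (WithLp.toLp (ENNReal.ofReal p) S) (WithLp.toLp (ENNReal.ofReal p) (T ∘ π)) := by
  obtain ⟨π, -, h⟩ := Finset.exists_mem_eq_inf' (s := Finset.univ) ⟨1, Finset.mem_univ _⟩
    (fun π : Equiv.Perm (Fin ℓ) =>
      dist (WithLp.toLp (ENNReal.ofReal p) S) (WithLp.toLp (ENNReal.ofReal p) (T ∘ π)))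
  exact ⟨π, by rw [dWS_eq_inf'_dist hp]; exact h⟩

theorem dist_comp_perm (hp : 1 ≤ p) [Fact (1 ≤ ENNReal.ofReal p)] (S T : Fin ℓ → X)
    (π : Equiv.Perm (Fin ℓ)) :
    dist (WithLp.toLp (ENNReal.ofReal p) (S ∘ π)) (WithLp.toLp (ENNReal.ofReal p) (T ∘ π)) =
      dist (WithLp.toLp (ENNReal.ofReal p) S) (WithLp.toLp (ENNReal.ofReal p) T) := by
  have h : (ENNReal.ofReal p).toReal = p := ENNReal.toReal_ofReal (by linarith)
  have h0 : 0 < (ENNReal.ofReal p).toReal := by rw [h]; linarith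
  rw [PiLp.dist_eq_sum h0, PiLp.dist_eq_sum h0]
  congr 1
  exact Equiv.sum_comp π
    (fun i => dist (S i) (T i) ^ (ENNReal.ofReal p).toReal)

/-- Composing optimal matchings from S to T and from T to U gives an admissible matching from S to
U, since permuting both arguments is an isometry of `PiLp`. -/
theorem dWS_triangle (hp : 1 ≤ p) (S T U : Fin ℓ → X) :
    dWS p S U ≤ dWS p S T + dWS p T U := by
  have : Fact (1 ≤ ENNReal.ofReal p) := ⟨by simpa using hp⟩
  obtain ⟨π, hπ⟩ := exists_dWS_eq_dist hp S T
  obtain ⟨ρ, hρ⟩ := exists_dWS_eq_dist hp T U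
  rw [hπ, hρ, ← dist_comp_perm hp T (U ∘ ρ) π]
  exact (dWS_le_dist hp S U (ρ * π)).trans (dist_triangle _ _ _)

theorem dWS_comm (hp : 1 ≤ p) (S T : Fin ℓ → X) : dWS p S T = dWS p T S := by
  have : Fact (1 ≤ ENNReal.ofReal p) := ⟨by simpa using hp⟩
  have key : ∀ S T : Fin ℓ → X, dWS p S T ≤ dWS p T S := by
    intro S T
    obtain ⟨π, hπ⟩ := exists_dWS_eq_dist hp T S
    refine (dWS_le_dist hp S T π⁻¹).trans (le_of_eq ?_)
    rw [hπ, dist_comm, ← dist_comp_perm hp (T ∘ (π⁻¹ : Equiv.Perm _)) S π]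
    congr 2
    funext i
    simp
  exact le_antisymm (key S T) (key T S)

theorem dWS_comp_perm (hp : 1 ≤ p) (S T : Fin ℓ → X) (π : Equiv.Perm (Fin ℓ)) :
    dWS p S (T ∘ π) = dWS p S T := by
  have : Fact (1 ≤ ENNReal.ofReal p) := ⟨by simpa using hp⟩
  have key : ∀ (T : Fin ℓ → X) (π : Equiv.Perm (Fin ℓ)), dWS p S (T ∘ π) ≤ dWS p S T := by
    intro T π
    obtain ⟨ρ, hρ⟩ := exists_dWS_eq_dist hp S T
    rw [hρ]
    refine (dWS_le_dist hp S (T ∘ π) (π⁻¹ * ρ)).trans (le_of_eq ?_)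
    congr 2
    funext i
    simp
  refine le_antisymm (key T π) ?_
  have h := key (T ∘ π) π⁻¹
  have e : (T ∘ π) ∘ (π⁻¹ : Equiv.Perm _) = T := by funext i; simp
  rwa [e] at h

end Wasserstein

/-! ### Nets in finite-dimensional normed spaces -/

section Net

open MeasureTheory Metric Module Function
open scoped ENNReal

variable {E : Type*} [NormedAddCommGroup E] [NormedSpace ℝ E] [FiniteDimensional ℝ E]

/-- Volume comparison: the balls of radius η/2 around the points are disjoint and lie in the ball of
radius R + η/2 around c. -/
theorem card_le_of_separated {R η : ℝ} (hR : 0 ≤ R) (hη : 0 < η) (c : E) (s : Finset E)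
    (hs : ∀ x ∈ s, dist x c ≤ R) (h : ∀ x ∈ s, ∀ y ∈ s, x ≠ y → η ≤ dist x y) :
    (s.card : ℝ) ≤ (1 + 2 * R / η) ^ finrank ℝ E := by
  borelize E
  let μ : Measure E := Measure.addHaar
  set A := ⋃ x ∈ s, ball (x : E) (η / 2) with hA
  have D : Set.Pairwise (s : Set E) (Disjoint on fun x => ball (x : E) (η / 2)) := by
    rintro x hx y hy hxy
    apply ball_disjoint_ball
    linarith [h x hx y hy hxy]
  have A_subset : A ⊆ ball c (R + η / 2) := by
    refine Set.iUnion₂_subset fun x hx => ?_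
    apply ball_subset_ball'
    linarith [hs x hx]
  have hη2 : 0 < η / 2 := by linarith
  have hρ : 0 < R + η / 2 := by linarith
  have I : (s.card : ℝ≥0∞) * ENNReal.ofReal ((η / 2) ^ finrank ℝ E) * μ (ball 0 1) ≤
      ENNReal.ofReal ((R + η / 2) ^ finrank ℝ E) * μ (ball 0 1) :=
    calc
      (s.card : ℝ≥0∞) * ENNReal.ofReal ((η / 2) ^ finrank ℝ E) * μ (ball 0 1) = μ A := by
        rw [hA, measure_biUnion_finset D fun c _ => measurableSet_ball]
        simp only [μ.addHaar_ball_of_pos _ hη2]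
        simp only [Finset.sum_const, nsmul_eq_mul, mul_assoc]
      _ ≤ μ (ball c (R + η / 2)) := measure_mono A_subset
      _ = ENNReal.ofReal ((R + η / 2) ^ finrank ℝ E) * μ (ball 0 1) := by
        simp only [μ.addHaar_ball_of_pos _ hρ]
  have J : (s.card : ℝ≥0∞) * ENNReal.ofReal ((η / 2) ^ finrank ℝ E) ≤
      ENNReal.ofReal ((R + η / 2) ^ finrank ℝ E) :=
    (ENNReal.mul_le_mul_iff_left (measure_ball_pos _ _ zero_lt_one).ne' measure_ball_lt_top.ne).1 I
  have K := ENNReal.toReal_le_of_le_ofReal (pow_nonneg hρ.le _) J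
  rw [ENNReal.toReal_mul, ENNReal.toReal_natCast, ENNReal.toReal_ofReal (by positivity)] at K
  rw [← le_div_iff₀ (by positivity), ← div_pow] at K
  refine K.trans (le_of_eq ?_)
  congr 1
  field_simp
  ring

/-- A separated set of maximal cardinality is a net, since an uncovered point could be added to it.
The volume bound guarantees that the maximum exists. -/
theorem exists_net {R η : ℝ} (hR : 0 ≤ R) (hη : 0 < η) (c : E) :
    ∃ s : Finset E, (s.card : ℝ) ≤ (1 + 2 * R / η) ^ finrank ℝ E ∧
      ∀ x, dist x c ≤ R → ∃ y ∈ s, dist x y ≤ η := by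
  classical
  let Q : ℕ → Prop := fun k => ∃ s : Finset E, s.card = k ∧ (∀ x ∈ s, dist x c ≤ R) ∧
    ∀ x ∈ s, ∀ y ∈ s, x ≠ y → η ≤ dist x y
  let b : ℕ := ⌊(1 + 2 * R / η) ^ finrank ℝ E⌋₊
  have hb : ∀ k, Q k → k ≤ b := by
    rintro k ⟨s, rfl, h1, h2⟩
    exact Nat.le_floor (card_le_of_separated hR hη c s h1 h2)
  have hQ0 : Q 0 := ⟨∅, by simp⟩
  obtain ⟨s, hcard, h1, h2⟩ : Q (Nat.findGreatest Q b) :=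
    Nat.findGreatest_spec (P := Q) (Nat.zero_le b) hQ0
  refine ⟨s, card_le_of_separated hR hη c s h1 h2, fun x hx => ?_⟩
  by_contra! hcon
  have hxs : x ∉ s := fun hxs => by
    have := hcon x hxs
    rw [dist_self] at this
    linarith
  have hQ : Q (s.card + 1) := by
    refine ⟨insert x s, Finset.card_insert_of_notMem hxs, ?_, ?_⟩
    · intro y hy
      rcases Finset.mem_insert.1 hy with rfl | hy
      exacts [hx, h1 y hy]
    · intro y hy z hz hyz
      rcases Finset.mem_insert.1 hy with hy | hy <;> rcases Finset.mem_insert.1 hz with hz | hz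
      · exact absurd (hy.trans hz.symm) hyz
      · rw [hy]; exact (hcon z hz).le
      · rw [hz, dist_comm]; exact (hcon y hy).le
      · exact h2 y hy z hz hyz
  have := Nat.le_findGreatest (hb _ hQ) hQ
  omega

/-- The tuples at Wasserstein distance at most `R` from `c` have a small `η`-net. -/
theorem exists_dWS_net {d ℓ : ℕ} {p R η : ℝ} (hp : 1 ≤ p) (hR : 0 ≤ R) (hη : 0 < η)
    (c : Fin ℓ → EuclideanSpace ℝ (Fin d)) :
    ∃ N : Finset (Fin ℓ → EuclideanSpace ℝ (Fin d)),
      (N.card : ℝ) ≤ (1 + 2 * R / η) ^ (d * ℓ) ∧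
      ∀ s, dWS p c s ≤ R → ∃ t ∈ N, ∀ x, |dWS p x s - dWS p x t| ≤ η := by
  classical
  have : Fact (1 ≤ ENNReal.ofReal p) := ⟨by simpa using hp⟩
  obtain ⟨N, hN, hcov⟩ := exists_net (E := PiLp (ENNReal.ofReal p)
    (fun _ : Fin ℓ => EuclideanSpace ℝ (Fin d))) hR hη (WithLp.toLp _ c)
  have hdim : finrank ℝ (PiLp (ENNReal.ofReal p)
    (fun _ : Fin ℓ => EuclideanSpace ℝ (Fin d))) = d * ℓ := by
    rw [(WithLp.linearEquiv (ENNReal.ofReal p) ℝ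
      (Fin ℓ → EuclideanSpace ℝ (Fin d))).finrank_eq]
    simp [Module.finrank_pi_fintype, mul_comm]
  rw [hdim] at hN
  refine ⟨N.image WithLp.ofLp, (Nat.cast_le.2 Finset.card_image_le).trans hN, fun s hs => ?_⟩
  -- Reordering s by an optimal matching moves it into the `PiLp` ball around c without changing any
  -- Wasserstein distance, so one net of that ball serves all matchings.
  obtain ⟨π, hπ⟩ := exists_dWS_eq_dist hp c s
  obtain ⟨y, hy, hxy⟩ := hcov (WithLp.toLp _ (s ∘ π)) (by rw [dist_comm, ← hπ]; exact hs)
  refine ⟨WithLp.ofLp y, Finset.mem_image_of_mem _ hy, fun x => ?_⟩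
  have hst : dWS p s (WithLp.ofLp y) ≤ η := by
    rw [dWS_comm hp, ← dWS_comp_perm hp _ s π, dWS_comm hp]
    exact (dWS_le_dist hp (s ∘ π) (WithLp.ofLp y) 1).trans hxy
  have h1 := dWS_triangle hp x (WithLp.ofLp y) s
  have h2 := dWS_triangle hp x s (WithLp.ofLp y)
  rw [dWS_comm hp (WithLp.ofLp y) s] at h1
  rw [abs_le]
  constructor <;> linarith

end Net

/-! ### Expectations and tail bounds for discrete distributions -/

section Expectation

open scoped ENNReal

variable {α β : Type*}

/-- The expectation of a nonnegative function. -/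
def expect (μ : PMF α) (f : α → ℝ≥0∞) : ℝ≥0∞ :=
  ∑' a, μ a * f a

theorem expect_pure (a : α) (f : α → ℝ≥0∞) : expect (PMF.pure a) f = f a := by
  unfold expect
  rw [tsum_eq_single a]
  · simp
  · intro b hb
    simp [PMF.pure_apply, hb]

theorem expect_bind (μ : PMF α) (g : α → PMF β) (f : β → ℝ≥0∞) :
    expect (μ.bind g) f = expect μ (fun a => expect (g a) f) := by
  unfold expect
  simp only [PMF.bind_apply, ← ENNReal.tsum_mul_right, ← ENNReal.tsum_mul_left]
  rw [ENNReal.tsum_comm]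
  simp only [mul_assoc]

theorem expect_map (μ : PMF α) (g : α → β) (f : β → ℝ≥0∞) :
    expect (μ.map g) f = expect μ (fun a => f (g a)) := by
  rw [PMF.map, expect_bind]
  simp only [Function.comp, expect_pure]

theorem expect_mono {μ : PMF α} {f g : α → ℝ≥0∞} (h : ∀ a ∈ μ.support, f a ≤ g a) :
    expect μ f ≤ expect μ g := by
  refine ENNReal.tsum_le_tsum fun a => ?_
  by_cases ha : μ a = 0
  · simp [ha]
  · gcongr
    exact h a ((PMF.mem_support_iff _ _).2 ha)

theorem expect_const_mul (μ : PMF α) (K : ℝ≥0∞) (f : α → ℝ≥0∞) :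
    expect μ (fun a => K * f a) = K * expect μ f := by
  unfold expect
  rw [← ENNReal.tsum_mul_left]
  congr 1
  funext a
  ring

theorem expect_const (μ : PMF α) (K : ℝ≥0∞) : expect μ (fun _ => K) = K := by
  unfold expect
  rw [ENNReal.tsum_mul_right, μ.tsum_coe, one_mul]

theorem toOuterMeasure_le_expect (μ : PMF α) (s : Set α) (f : α → ℝ≥0∞)
    (h : ∀ a ∈ s, 1 ≤ f a) : μ.toOuterMeasure s ≤ expect μ f := by
  rw [PMF.toOuterMeasure_apply]
  refine ENNReal.tsum_le_tsum fun a => ?_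
  by_cases ha : a ∈ s
  · rw [Set.indicator_of_mem ha]
    exact le_mul_of_one_le_right (zero_le) (h a ha)
  · simp [ha]

theorem toOuterMeasure_bind_le {μ : PMF α} {g : α → PMF β} {s : Set β} {K : ℝ≥0∞}
    (h : ∀ a ∈ μ.support, (g a).toOuterMeasure s ≤ K) :
    (μ.bind g).toOuterMeasure s ≤ K := by
  rw [PMF.toOuterMeasure_bind_apply]
  exact (expect_mono h).trans (expect_const μ K).le

theorem toOuterMeasure_add_compl (μ : PMF α) (s : Set α) :
    μ.toOuterMeasure s + μ.toOuterMeasure sᶜ = 1 := by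
  rw [PMF.toOuterMeasure_apply, PMF.toOuterMeasure_apply, ← ENNReal.tsum_add, ← μ.tsum_coe]
  congr 1
  funext a
  exact Set.indicator_self_add_compl_apply s _ a

theorem le_toOuterMeasure_of_compl {μ : PMF α} {s : Set α} {δ : ℝ} (hδ : 0 ≤ δ)
    (h : μ.toOuterMeasure sᶜ ≤ ENNReal.ofReal δ) :
    ENNReal.ofReal (1 - δ) ≤ μ.toOuterMeasure s := by
  rw [ENNReal.ofReal_sub _ hδ, ENNReal.ofReal_one, tsub_le_iff_right,
    ← toOuterMeasure_add_compl μ s]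
  gcongr

theorem toOuterMeasure_le_of_support {μ : PMF α} {s t : Set α}
    (h : ∀ a ∈ μ.support, a ∈ s → a ∈ t) : μ.toOuterMeasure s ≤ μ.toOuterMeasure t :=
  PMF.toOuterMeasure_mono μ fun a ha => h a ha.2 ha.1

/-! ### Uniform draws and Hoeffding's lemma. -/

theorem expect_uniformBelow {M : ℕ} (hM : 0 < M) (f : ℕ → ℝ) (hf : ∀ v, 0 ≤ f v) :
    expect (uniformBelow M) (fun v => ENNReal.ofReal (f v)) =
      ENNReal.ofReal ((∑ v ∈ Finset.range M, f v) / M) := by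
  obtain ⟨M, rfl⟩ := Nat.exists_eq_succ_of_ne_zero hM.ne'
  unfold uniformBelow
  rw [expect_map]
  unfold expect
  rw [tsum_fintype]
  simp only [PMF.uniformOfFintype_apply, Fintype.card_fin]
  rw [← Finset.mul_sum, Fin.sum_univ_eq_sum_range (fun v => ENNReal.ofReal (f v)) (M + 1),
    ← ENNReal.ofReal_sum_of_nonneg (fun v _ => hf v), ENNReal.ofReal_div_of_pos (by positivity),
    ENNReal.ofReal_natCast, mul_comm, div_eq_mul_inv]

theorem support_uniformBelow {M v : ℕ} (hM : 0 < M) (hv : v ∈ (uniformBelow M).support) :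
    v < M := by
  obtain ⟨M, rfl⟩ := Nat.exists_eq_succ_of_ne_zero hM.ne'
  unfold uniformBelow at hv
  rw [PMF.support_map] at hv
  obtain ⟨w, -, rfl⟩ := hv
  exact w.2

/-- By convexity the exponential lies below its chord over [-B, B]. The linear term disappears when
averaged over centered values. -/
theorem exp_le_cosh_add_sinh {y B : ℝ} (hB : 0 < B) (hy : |y| ≤ B) :
    Real.exp y ≤ Real.cosh B + y / B * Real.sinh B := by
  obtain ⟨h1, h2⟩ := abs_le.1 hy
  have h : Real.exp (((B - y) / (2 * B)) • (-B) + ((B + y) / (2 * B)) • B) ≤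
      ((B - y) / (2 * B)) • Real.exp (-B) + ((B + y) / (2 * B)) • Real.exp B :=
    convexOn_exp.2 (Set.mem_univ (-B)) (Set.mem_univ B)
      (div_nonneg (by linarith) (by linarith)) (div_nonneg (by linarith) (by linarith))
      (by field_simp; ring)
  simp only [smul_eq_mul] at h
  have e : (B - y) / (2 * B) * -B + (B + y) / (2 * B) * B = y := by field_simp; ring
  rw [e] at h
  refine h.trans (le_of_eq ?_)
  rw [Real.cosh_eq, Real.sinh_eq]
  field_simp
  ring

/-- Hoeffding's lemma for a uniform average. -/
theorem sum_exp_le {M : ℕ} {y : ℕ → ℝ} {B : ℝ} (hy : ∀ v < M, |y v| ≤ B)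
    (h0 : ∑ v ∈ Finset.range M, y v = 0) :
    ∑ v ∈ Finset.range M, Real.exp (y v) ≤ M * Real.exp (B ^ 2 / 2) := by
  rcases Nat.eq_zero_or_pos M with rfl | hM
  · simp
  have hB : 0 ≤ B := (abs_nonneg _).trans (hy 0 hM)
  rcases hB.eq_or_lt with rfl | hB
  · have : ∀ v ∈ Finset.range M, Real.exp (y v) = 1 := fun v hv => by
      rw [abs_nonpos_iff.1 (hy v (Finset.mem_range.1 hv)), Real.exp_zero]
    rw [Finset.sum_congr rfl this]
    simp
  · calc ∑ v ∈ Finset.range M, Real.exp (y v)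
        ≤ ∑ v ∈ Finset.range M, (Real.cosh B + y v / B * Real.sinh B) :=
          Finset.sum_le_sum fun v hv =>
            exp_le_cosh_add_sinh hB (hy v (Finset.mem_range.1 hv))
      _ = M * Real.cosh B := by
          rw [Finset.sum_add_distrib, ← Finset.sum_mul, ← Finset.sum_div, h0]
          simp
      _ ≤ M * Real.exp (B ^ 2 / 2) := by
          gcongr
          exact Real.cosh_le_exp_half_sq B

/-- Hoeffding's lemma for a uniform average of bounded numbers with mean `μ`. -/
theorem sum_exp_div_le {M : ℕ} (hM : 0 < M) {z : ℕ → ℝ} {μ B : ℝ} (hz : ∀ v < M, |z v| ≤ B)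
    (hμ : ∑ v ∈ Finset.range M, z v = M * μ) :
    (∑ v ∈ Finset.range M, Real.exp (z v)) / M ≤ Real.exp (μ + 2 * B ^ 2) := by
  have hM' : (0 : ℝ) < M := by exact_mod_cast hM
  have hμB : |μ| ≤ B := by
    have h1 : |∑ v ∈ Finset.range M, z v| ≤ M * B := by
      refine (Finset.abs_sum_le_sum_abs _ _).trans ?_
      refine (Finset.sum_le_sum fun v hv => hz v (Finset.mem_range.1 hv)).trans ?_
      simp
    rw [hμ, abs_mul, abs_of_pos hM'] at h1
    exact le_of_mul_le_mul_left h1 hM'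
  -- Centering at most doubles the range, and (2B)²/2 = 2B².
  have h := sum_exp_le (M := M) (y := fun v => z v - μ) (B := 2 * B)
    (fun v hv => by
      have h1 := abs_le.1 (hz v hv)
      have h2 := abs_le.1 hμB
      exact abs_le.2 ⟨by linarith, by linarith⟩)
    (by rw [Finset.sum_sub_distrib, hμ]; simp)
  have e : ∀ v, Real.exp (z v) = Real.exp μ * Real.exp (z v - μ) := fun v => by
    rw [← Real.exp_add]; congr 1; ring
  simp only [e, ← Finset.mul_sum]
  rw [div_le_iff₀ hM', Real.exp_add]
  calc _ ≤ Real.exp μ * (M * Real.exp ((2 * B) ^ 2 / 2)) := by gcongr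
    _ = _ := by ring_nf

end Expectation

/-! ### Program logic -/

section Logic

open scoped ENNReal

/-- Assertions about memory contents. -/
abbrev Assertion := (ℕ → ℕ → ℕ) → (ℕ → ℕ → ℝ) → Prop

/-- Started in a state satisfying `Q`, the program ends in a state satisfying `R`
after at most `t` steps. -/
def Triple (D : ℕ → ℕ → ℝ) (T : ℕ) (Q : Assertion) (A : Prog) (t : ℕ) (R : Assertion) : Prop :=
  ∀ σ : State, Q σ.nat σ.real → ∀ σ' ∈ (A.run D T σ).support,
    R σ'.nat σ'.real ∧ σ'.time ≤ σ.time + t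

variable {D : ℕ → ℕ → ℝ} {T : ℕ}

theorem Triple.seq {Q R S : Assertion} {A B : Prog} {t u : ℕ} (hA : Triple D T Q A t R)
    (hB : Triple D T R B u S) : Triple D T Q (.seq A B) (t + u) S := by
  intro σ hσ τ hτ
  rw [Prog.run, PMF.mem_support_bind_iff] at hτ
  obtain ⟨ρ, hρ, hτ⟩ := hτ
  obtain ⟨h1, h2⟩ := hA σ hσ ρ hρ
  obtain ⟨h3, h4⟩ := hB ρ h1 τ hτ
  exact ⟨h3, by omega⟩

theorem Triple.weaken {Q Q' R R' : Assertion} {A : Prog} {t t' : ℕ} (h : Triple D T Q A t R)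
    (hQ : ∀ N X, Q' N X → Q N X) (hR : ∀ N X, R N X → R' N X) (ht : t ≤ t') :
    Triple D T Q' A t' R' := by
  intro σ hσ τ hτ
  obtain ⟨h1, h2⟩ := h σ (hQ _ _ hσ) τ hτ
  exact ⟨hR _ _ h1, by omega⟩

theorem iterate_support {f : State → PMF State} {t : ℕ} {I : ℕ → Assertion} {m : ℕ}
    (hf : ∀ k < m, ∀ σ : State, I k σ.nat σ.real → ∀ σ' ∈ (f σ).support,
      I (k + 1) σ'.nat σ'.real ∧ σ'.time ≤ σ.time + t) :
    ∀ (j k : ℕ), k + j ≤ m → ∀ σ : State, I k σ.nat σ.real → ∀ σ' ∈ (iterate f j σ).support,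
      I (k + j) σ'.nat σ'.real ∧ σ'.time ≤ σ.time + j * (t + 1) := by
  intro j
  induction j with
  | zero =>
    intro k _ σ hσ τ hτ
    rw [iterate, PMF.mem_support_pure_iff] at hτ
    subst hτ
    exact ⟨hσ, by omega⟩
  | succ j ih =>
    intro k hk σ hσ τ hτ
    rw [iterate, PMF.mem_support_bind_iff] at hτ
    obtain ⟨ρ, hρ, hτ⟩ := hτ
    obtain ⟨h1, h2⟩ := hf k (by omega) (σ.tick 1) hσ ρ hρ
    obtain ⟨h3, h4⟩ := ih (k + 1) (by omega) ρ h1 τ hτ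
    refine ⟨by rwa [show k + (j + 1) = k + 1 + j by ring], ?_⟩
    simp only [State.tick] at h2
    have : (j + 1) * (t + 1) = j * (t + 1) + (t + 1) := by ring
    omega

/-- The loop rule: `I k` is the invariant after `k` iterations. -/
theorem Triple.loop {e : NExpr} {A : Prog} {t m : ℕ} (I : ℕ → Assertion) {Q : Assertion}
    (hQ : ∀ N X, Q N X → I 0 N X)
    (he : ∀ σ : State, Q σ.nat σ.real → e.eval σ = m)
    (hA : ∀ k < m, Triple D T (I k) A t (I (k + 1))) :
    Triple D T Q (.loop e A) (m * (t + 1) + e.cost + 1) (I m) := by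
  intro σ hσ τ hτ
  rw [Prog.run, he σ hσ] at hτ
  obtain ⟨h1, h2⟩ := iterate_support (m := m) (t := t) (I := I)
    (fun k hk σ => hA k hk σ) m 0 (by omega) (σ.tick (e.cost + 1)) (hQ _ _ hσ) τ hτ
  rw [zero_add] at h1
  refine ⟨h1, ?_⟩
  simp only [State.tick] at h2
  omega

/-- With h an exponential of the running sum, this replaces the product formula for moment
generating functions of independent samples. The function h has to ignore the clock, which advances
in every iteration. -/
theorem expect_iterate_le {f : State → PMF State} {J : Assertion} {h : State → ℝ≥0∞} {K : ℝ≥0∞}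
    (hJ : ∀ σ : State, J σ.nat σ.real → ∀ σ' ∈ (f σ).support, J σ'.nat σ'.real)
    (hh : ∀ σ : State, J σ.nat σ.real → expect (f σ) h ≤ K * h σ)
    (htick : ∀ σ t, h (State.tick σ t) = h σ) :
    ∀ (m : ℕ) (σ : State), J σ.nat σ.real → expect (iterate f m σ) h ≤ K ^ m * h σ := by
  intro m
  induction m with
  | zero =>
    intro σ _
    rw [iterate, expect_pure]
    simp
  | succ m ih =>
    intro σ hσ
    rw [iterate, expect_bind]
    calc expect (f (σ.tick 1)) (fun τ => expect (iterate f m τ) h)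
        ≤ expect (f (σ.tick 1)) (fun τ => K ^ m * h τ) :=
          expect_mono fun τ hτ => ih τ (hJ (σ.tick 1) hσ τ hτ)
      _ = K ^ m * expect (f (σ.tick 1)) h := expect_const_mul _ _ _
      _ ≤ K ^ m * (K * h (σ.tick 1)) := by gcongr; exact hh (σ.tick 1) hσ
      _ = K ^ (m + 1) * h σ := by rw [htick]; ring

end Logic

/-! ### The algorithm -/

section Program

/-- The natural scalar variable stored in cell `0` of array `a`. -/
abbrev nvar (a : ℕ) : NExpr := .get a (.lit 0)

/-- The real scalar variable stored in cell `0` of array `a`. -/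
abbrev rvar (a : ℕ) : RExpr := .get a (.lit 0)

/-- Computes in the scalar `L` how often `1` can be doubled, but at most `n` times, until the product
with the input parameter in cell `j` exceeds `1`. The scalar `r` holds the power of `2`. -/
def doublingBody (j r L : ℕ) : Prog :=
  .ite (.rle (.mul (rvar r) (.get 0 (.lit j))) (.ofNat (.lit 1)))
    (.seq (.setR r (.lit 0) (.add (rvar r) (rvar r)))
      (.setR L (.lit 0) (.add (rvar L) (.ofNat (.lit 1)))))
    .skip

/-- A substitute for the logarithm, which the machine lacks. The cap n keeps the time linear; it is
harmless because a capped value forces so many samples that all points are output. -/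
def doubling (j r L : ℕ) : Prog :=
  .seq (.setR r (.lit 0) (.ofNat (.lit 1))) (.loop (nvar 0) (doublingBody j r L))

/-- The real number of samples `512 / ε² * (d * ℓ * (8 + 2 * L₁) + L₂)`. -/
def sampleBound : RExpr :=
  .mul (.div (.ofNat (.lit 512)) (.mul (.get 0 (.lit 1)) (.get 0 (.lit 1))))
    (.add (.mul (.mul (.ofNat (.get 0 (.lit 1))) (.ofNat (.get 0 (.lit 2))))
      (.add (.ofNat (.lit 8)) (.add (rvar 5) (rvar 5)))) (rvar 7))

/-- Rounds the number of samples up, but at most to `n`. -/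
def roundUp : Prog :=
  .seq (.setR 8 (.lit 0) sampleBound)
    (.loop (nvar 0) (.ite (.rle (rvar 8) (.ofNat (nvar 2))) .skip
      (.setN 2 (.lit 0) (.add (nvar 2) (.lit 1)))))

/-- Memory layout of the whole program. Natural arrays: 2 sample size m, 3 current point, 4 number
of slots, 5 owners of slots, 6 slot counts of points, 7 drawn slot. Real arrays: 1 weights, 2
distances to c, 3 their sum, 5 and 7 the logarithms of 1/ε and 1/δ, 8 the unrounded sample size, 4
and 6 powers of two. -/
def sampleSize : Prog :=
  .seq (doubling 1 4 5) (.seq (doubling 2 6 7) roundUp)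

/-- Outputs all data points with weight `1`. -/
def outputAll : Prog :=
  .loop (nvar 0) (.seq (.setR 1 (nvar 3) (.ofNat (.lit 1)))
    (.setN 3 (.lit 0) (.add (nvar 3) (.lit 1))))

/-- Computes the distances to the center and their sum, which is replaced by `1` if it is `0`. -/
def distances : Prog :=
  .seq (.loop (nvar 0) (.seq (.dist 2 (nvar 3) (nvar 3) (nvar 0))
      (.seq (.setR 3 (.lit 0) (.add (rvar 3) (.get 2 (nvar 3))))
        (.setN 3 (.lit 0) (.add (nvar 3) (.lit 1))))))
    (.seq (.ite (.rle (rvar 3) (.ofNat (.lit 0))) (.setR 3 (.lit 0) (.ofNat (.lit 1))) .skip)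
      (.setN 3 (.lit 0) (.lit 0)))

/-- Assigns one more slot to the current point, and moves on to the next point as soon as the number
of its slots is large enough. -/
def slotBody : Prog :=
  .ite (.nle (nvar 0) (nvar 3)) .skip
    (.seq (.setN 5 (nvar 4) (nvar 3)) (.seq (.setN 4 (.lit 0) (.add (nvar 4) (.lit 1)))
      (.seq (.setN 6 (nvar 3) (.add (.get 6 (nvar 3)) (.lit 1)))
        (.ite (.rle (.mul (.ofNat (nvar 0)) (.get 2 (nvar 3)))
            (.mul (.ofNat (.get 6 (nvar 3))) (rvar 3)))
          (.setN 3 (.lit 0) (.add (nvar 3) (.lit 1))) .skip))))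

/-- Every active iteration creates a slot, and at most 2n slots are ever created, so 2n iterations
reach the last point. -/
def assignSlots : Prog :=
  .loop (.add (nvar 0) (nvar 0)) slotBody

/-- Draws a slot and increases the weight of its owner. -/
def sampleBody : Prog :=
  .seq (.rand 7 (.lit 0) (nvar 4))
    (.setR 1 (.get 5 (nvar 7)) (.add (.get 1 (.get 5 (nvar 7)))
      (.div (.ofNat (nvar 4)) (.mul (.ofNat (nvar 2)) (.ofNat (.get 6 (.get 5 (nvar 7))))))))

def sampling : Prog :=
  .loop (nvar 2) sampleBody

/-- The coreset algorithm. -/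
def coresetProg : Prog :=
  .seq sampleSize (.ite (.nle (nvar 0) (nvar 2)) outputAll
    (.seq (.seq distances assignSlots) sampling))

end Program

/-! ### Deterministic part -/

section Deterministic

variable {D : ℕ → ℕ → ℝ} {T : ℕ}

/-- `L` is the base-`2` logarithm of `1 / x`, rounded up and truncated at `n`. -/
def IsLog (n : ℕ) (x L : ℝ) : Prop :=
  ∃ k : ℕ, L = k ∧ (k = n ∨ 1 < 2 ^ k * x) ∧ (k = 0 ∨ 2 ^ k * x ≤ 2)

theorem doubling_triple {n j r L : ℕ} {x : ℝ} {N₀ : ℕ → ℕ → ℕ} {X₀ : ℕ → ℕ → ℝ} (hr : r ≠ L)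
    (hr0 : r ≠ 0) (hL0 : L ≠ 0) (hn : N₀ 0 0 = n) (hx : X₀ 0 j = x) (hL : X₀ L 0 = 0) :
    Triple D T (fun N X => N = N₀ ∧ X = X₀) (doubling j r L) (n * 24 + 8)
      (fun N X => N = N₀ ∧ (∀ b, b ≠ r → b ≠ L → X b = X₀ b) ∧ IsLog n x (X L 0)) := by
  have h1 : Triple D T (fun N X => N = N₀ ∧ X = X₀)
      (.setR r (.lit 0) (.ofNat (.lit 1))) 4
      (fun N X => N = N₀ ∧ (∀ b, b ≠ r → b ≠ L → X b = X₀ b) ∧ X L 0 = 0 ∧ X r 0 = 1) := by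
    rintro ⟨N, X, τ⟩ ⟨hN, hX⟩ σ' hσ'
    dsimp only at hN hX
    subst hN hX
    simp only [Prog.run, PMF.support_pure, Set.mem_singleton_iff] at hσ'
    subst hσ'
    refine ⟨⟨rfl, fun b hb _ => ?_, ?_, ?_⟩, le_refl _⟩
    · funext i
      simp [State.putR, State.tick, hb]
    · simp [State.putR, State.tick, hr.symm, hL]
    · simp [State.putR, State.tick, NExpr.eval, RExpr.eval]
  have h2 := Triple.loop (D := D) (T := T) (e := nvar 0) (A := doublingBody j r L) (t := 23)
    (m := n) (Q := fun N X => N = N₀ ∧ (∀ b, b ≠ r → b ≠ L → X b = X₀ b) ∧ X L 0 = 0 ∧ X r 0 = 1)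
    (fun t N X => N = N₀ ∧ (∀ b, b ≠ r → b ≠ L → X b = X₀ b) ∧ ∃ k : ℕ, X L 0 = k ∧
      X r 0 = 2 ^ k ∧ (k = t ∨ 1 < 2 ^ k * x) ∧ (k = 0 ∨ 2 ^ k * x ≤ 2))
    (fun N X ⟨h1, h2, h3, h4⟩ => ⟨h1, h2, 0, by simpa using h3, by simpa using h4,
      Or.inl rfl, Or.inl rfl⟩)
    (fun σ h => by simp [NExpr.eval, h.1, hn]) ?_
  · refine (h1.seq h2).weaken (fun _ _ h => h) ?_ ?_
    · rintro N X ⟨h1, h2, k, h3, -, h4, h5⟩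
      exact ⟨h1, h2, k, h3, h4, h5⟩
    · simp only [NExpr.cost]; omega
  · rintro t - ⟨N, X, τ⟩ ⟨hN, hX, k, hk, hr', h3, h4⟩ σ' hσ'
    dsimp only at hN hX hk hr'
    have hx' : X 0 j = x := by rw [hX 0 hr0.symm hL0.symm, hx]
    simp only [doublingBody, Prog.run, PMF.pure_bind] at hσ'
    split_ifs at hσ' with htest
    · simp only [PMF.support_pure, Set.mem_singleton_iff] at hσ'
      subst hσ'
      simp only [Test.holds, RExpr.eval, NExpr.eval, hr', hx', Nat.cast_one] at htest
      refine ⟨⟨hN, fun b hb hb' => ?_, k + 1, ?_, ?_, ?_, ?_⟩, ?_⟩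
      · funext i
        simp [State.putR, State.tick, hb, hb', hX b hb hb']
      · simp [State.putR, State.tick, RExpr.eval, NExpr.eval, hr.symm, hk]
      · simp [State.putR, State.tick, RExpr.eval, NExpr.eval, hr, hr']
        ring
      · rcases h3 with h3 | h3
        · exact Or.inl (by rw [h3])
        · linarith
      · right
        rw [pow_succ]
        linarith
      · simp [State.putR, State.tick, RExpr.cost, NExpr.cost, Test.cost]
    · simp only [PMF.support_pure, Set.mem_singleton_iff] at hσ'
      subst hσ'
      simp only [Test.holds, RExpr.eval, NExpr.eval, hr', hx', Nat.cast_one, not_le] at htest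
      refine ⟨⟨hN, hX, k, hk, hr', Or.inr htest, h4⟩, ?_⟩
      simp [State.tick, RExpr.cost, NExpr.cost, Test.cost]

/-- `m` is `x` rounded up and truncated at `n`. -/
def IsRounded (n : ℕ) (x : ℝ) (m : ℕ) : Prop :=
  (m = n ∨ x ≤ m) ∧ (m = 0 ∨ (m : ℝ) ≤ x + 1)

theorem roundUp_triple {n d ℓ : ℕ} {ε L₁ L₂ : ℝ} :
    Triple D T (fun N X => N 0 0 = n ∧ N 0 1 = d ∧ N 0 2 = ℓ ∧ (∀ b, 2 ≤ b → N b = 0) ∧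
        X 0 1 = ε ∧ X 5 0 = L₁ ∧ X 7 0 = L₂ ∧ X 1 = 0 ∧ X 3 = 0)
      roundUp (n * 14 + 38)
      (fun N X => N 0 0 = n ∧ (∀ b, 3 ≤ b → N b = 0) ∧ X 1 = 0 ∧ X 3 = 0 ∧
        IsRounded n (512 / (ε * ε) * (d * ℓ * (8 + (L₁ + L₁)) + L₂)) (N 2 0)) := by
  set x : ℝ := 512 / (ε * ε) * (d * ℓ * (8 + (L₁ + L₁)) + L₂) with hx
  have h1 : Triple D T (fun N X => N 0 0 = n ∧ N 0 1 = d ∧ N 0 2 = ℓ ∧ (∀ b, 2 ≤ b → N b = 0) ∧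
        X 0 1 = ε ∧ X 5 0 = L₁ ∧ X 7 0 = L₂ ∧ X 1 = 0 ∧ X 3 = 0)
      (.setR 8 (.lit 0) sampleBound) 34
      (fun N X => N 0 0 = n ∧ (∀ b, 2 ≤ b → N b = 0) ∧ X 1 = 0 ∧ X 3 = 0 ∧ X 8 0 = x) := by
    rintro ⟨N, X, τ⟩ ⟨h1, h2, h3, h4, h5, h6, h7, h8, h9⟩ σ' hσ'
    dsimp only at h1 h2 h3 h4 h5 h6 h7 h8 h9
    simp only [Prog.run, PMF.support_pure, Set.mem_singleton_iff] at hσ'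
    subst hσ'
    refine ⟨⟨h1, h4, ?_, ?_, ?_⟩, ?_⟩
    · funext i; simp [State.putR, State.tick, h8]
    · funext i; simp [State.putR, State.tick, h9]
    · simp [State.putR, State.tick, NExpr.eval, RExpr.eval, sampleBound, h2, h3, h5, h6, h7, hx]
    · simp [State.putR, State.tick, NExpr.cost, RExpr.cost, sampleBound]
  have h2 := Triple.loop (D := D) (T := T) (e := nvar 0)
    (A := .ite (.rle (rvar 8) (.ofNat (nvar 2))) .skip
      (.setN 2 (.lit 0) (.add (nvar 2) (.lit 1)))) (t := 13)
    (m := n) (Q := fun N X => N 0 0 = n ∧ (∀ b, 2 ≤ b → N b = 0) ∧ X 1 = 0 ∧ X 3 = 0 ∧ X 8 0 = x)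
    (fun t N X => N 0 0 = n ∧ (∀ b, 3 ≤ b → N b = 0) ∧ X 1 = 0 ∧ X 3 = 0 ∧ X 8 0 = x ∧
      IsRounded t x (N 2 0))
    (fun N X ⟨h1, h2, h3, h4, h5⟩ => ⟨h1, fun b hb => h2 b (by omega), h3, h4, h5,
      Or.inl (by simp [h2 2 le_rfl]), Or.inl (by simp [h2 2 le_rfl])⟩)
    (fun σ h => by simp [NExpr.eval, h.1]) ?_
  · refine (h1.seq h2).weaken (fun _ _ h => h) ?_ ?_
    · rintro N X ⟨h1, h2, h3, h4, -, h5⟩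
      exact ⟨h1, h2, h3, h4, h5⟩
    · simp only [NExpr.cost]; omega
  · rintro t - ⟨N, X, τ⟩ ⟨h1, h2, h3, h4, h5, h6, h7⟩ σ' hσ'
    dsimp only at h1 h2 h3 h4 h5 h6 h7
    simp only [Prog.run] at hσ'
    split_ifs at hσ' with htest
    · simp only [PMF.support_pure, Set.mem_singleton_iff] at hσ'
      subst hσ'
      simp only [Test.holds, RExpr.eval, NExpr.eval, h5] at htest
      refine ⟨⟨h1, h2, h3, h4, h5, Or.inr htest, h7⟩, ?_⟩
      simp [State.tick, RExpr.cost, NExpr.cost, Test.cost]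
    · simp only [PMF.support_pure, Set.mem_singleton_iff] at hσ'
      subst hσ'
      simp only [Test.holds, RExpr.eval, NExpr.eval, h5, not_le] at htest
      refine ⟨⟨?_, fun b hb => ?_, h3, h4, h5, ?_, ?_⟩, ?_⟩
      · simp [State.putN, State.tick, h1]
      · funext i
        simp [State.putN, State.tick, h2 b hb, show b ≠ 2 by omega]
      · left
        simp only [State.putN, State.tick, NExpr.eval, and_self, if_true]
        rcases h6 with h6 | h6
        · rw [h6]
        · linarith
      · right
        simp only [State.putN, State.tick, NExpr.eval, and_self, if_true]
        push_cast
        linarith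
      · simp [State.putN, State.tick, RExpr.cost, NExpr.cost, Test.cost]

theorem sampleSize_triple {n d ℓ : ℕ} {p ε δ : ℝ} :
    Triple D T (fun N X => N = (input n d ℓ p ε δ).nat ∧ X = (input n d ℓ p ε δ).real)
      sampleSize (n * 62 + 54)
      (fun N X => N 0 0 = n ∧ (∀ b, 3 ≤ b → N b = 0) ∧ X 1 = 0 ∧ X 3 = 0 ∧
        ∃ L₁ L₂, IsLog n ε L₁ ∧ IsLog n δ L₂ ∧
          IsRounded n (512 / (ε * ε) * (d * ℓ * (8 + (L₁ + L₁)) + L₂)) (N 2 0)) := by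
  rintro σ ⟨hN, hX⟩ σ' hσ'
  simp only [sampleSize, Prog.run, PMF.mem_support_bind_iff] at hσ'
  obtain ⟨ρ, hρ, τ, hτ, hσ'⟩ := hσ'
  obtain ⟨⟨a1, a2, a3⟩, a4⟩ := doubling_triple (D := D) (T := T) (n := n) (j := 1) (r := 4) (L := 5)
    (x := ε) (N₀ := σ.nat) (X₀ := σ.real) (by decide) (by decide) (by decide)
    (by simp [hN, input]) (by simp [hX, input]) (by simp [hX, input]) σ ⟨rfl, rfl⟩ ρ hρ
  have e : ∀ b, b ≠ 4 → b ≠ 5 → b ≠ 0 → ρ.real b = 0 := fun b h4 h5 h0 => by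
    rw [a2 b h4 h5, hX]; funext i; simp [input, h0]
  obtain ⟨⟨b1, b2, b3⟩, b4⟩ := doubling_triple (D := D) (T := T) (n := n) (j := 2) (r := 6) (L := 7)
    (x := δ) (N₀ := ρ.nat) (X₀ := ρ.real) (by decide) (by decide) (by decide)
    (by simp [a1, hN, input]) (by rw [a2 0 (by decide) (by decide), hX]; simp [input])
    (by rw [e 7 (by decide) (by decide) (by decide)]; rfl) ρ ⟨rfl, rfl⟩ τ hτ
  obtain ⟨⟨c1, c2, c3, c4, c5⟩, c6⟩ := roundUp_triple (D := D) (T := T) (n := n) (d := d) (ℓ := ℓ)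
    (ε := ε) (L₁ := ρ.real 5 0) (L₂ := τ.real 7 0) τ
    ⟨by simp [b1, a1, hN, input], by simp [b1, a1, hN, input], by simp [b1, a1, hN, input],
      fun b hb => by
        funext i
        rw [b1, a1, hN]
        simp [input, show b ≠ 0 by omega],
      by rw [b2 0 (by decide) (by decide), a2 0 (by decide) (by decide), hX]; simp [input],
      by rw [b2 5 (by decide) (by decide)], rfl,
      by rw [b2 1 (by decide) (by decide), e 1 (by decide) (by decide) (by decide)],
      by rw [b2 3 (by decide) (by decide), e 3 (by decide) (by decide) (by decide)]⟩ σ' hσ'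
  exact ⟨⟨c1, c2, c3, c4, _, _, a3, b3, c5⟩, by omega⟩

theorem outputAll_triple {n : ℕ} :
    Triple D T (fun N _ => N 0 0 = n ∧ N 3 0 = 0) outputAll (n * 15 + 3)
      (fun _ X => ∀ i < n, X 1 i = 1) := by
  refine (Triple.loop (m := n) (t := 14) (fun t N X => N 3 0 = t ∧ ∀ i < t, X 1 i = 1)
    (fun N X h => ⟨h.2, by simp⟩) (fun σ h => by simp [NExpr.eval, h.1]) ?_).weaken
    (fun _ _ h => h) (fun N X h => h.2) (by simp only [NExpr.cost]; omega)
  rintro t - ⟨N, X, τ⟩ ⟨h1, h2⟩ σ' hσ'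
  dsimp only at h1 h2
  simp only [Prog.run, PMF.pure_bind, PMF.support_pure, Set.mem_singleton_iff] at hσ'
  subst hσ'
  refine ⟨⟨by simp [State.putR, State.putN, State.tick, NExpr.eval, h1], fun i hi => ?_⟩, ?_⟩
  · simp only [State.putR, State.putN, State.tick, NExpr.eval, RExpr.eval, h1, true_and]
    split_ifs with hit
    · simp
    · exact h2 i (by omega)
  · simp [State.putR, State.putN, State.tick, NExpr.cost, RExpr.cost]

/-- The index n lies outside the data, so the oracle reads it as the center. If all distances
vanish, the substitute total 1 stays positive and leads to exactly one slot per point. -/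
theorem distances_triple {n m : ℕ} (hD : ∀ i < n, 0 ≤ D i n) :
    Triple D T (fun N X => N 0 0 = n ∧ N 2 0 = m ∧ (∀ b, 3 ≤ b → N b = 0) ∧ X 1 = 0 ∧ X 3 = 0)
      distances (n * (T + 30) + 20)
      (fun N X => N 0 0 = n ∧ N 2 0 = m ∧ (∀ b, 3 ≤ b → N b 0 = 0) ∧ (∀ b, 4 ≤ b → N b = 0) ∧
        X 1 = 0 ∧ (∀ i < n, X 2 i = D i n) ∧ 0 < X 3 0 ∧ ∑ i ∈ Finset.range n, D i n ≤ X 3 0 ∧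
        ((∑ i ∈ Finset.range n, D i n) = X 3 0 ∨ (∑ i ∈ Finset.range n, D i n) = 0)) := by
  have h1 := Triple.loop (D := D) (T := T) (e := nvar 0)
    (A := .seq (.dist 2 (nvar 3) (nvar 3) (nvar 0))
      (.seq (.setR 3 (.lit 0) (.add (rvar 3) (.get 2 (nvar 3))))
        (.setN 3 (.lit 0) (.add (nvar 3) (.lit 1))))) (t := T + 29) (m := n)
    (Q := fun N X => N 0 0 = n ∧ N 2 0 = m ∧ (∀ b, 3 ≤ b → N b = 0) ∧ X 1 = 0 ∧ X 3 = 0)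
    (fun t N X => N 0 0 = n ∧ N 2 0 = m ∧ N 3 0 = t ∧ (∀ b, 4 ≤ b → N b = 0) ∧ X 1 = 0 ∧
      (∀ i < t, X 2 i = D i n) ∧ X 3 0 = ∑ i ∈ Finset.range t, D i n)
    (fun N X ⟨h1, h2, h3, h4, h5⟩ => ⟨h1, h2, by simp [h3 3 le_rfl],
      fun b hb => h3 b (by omega), h4, by simp, by simp [h5]⟩)
    (fun σ h => by simp [NExpr.eval, h.1]) ?_
  · have h2 : Triple D T (fun N X => N 0 0 = n ∧ N 2 0 = m ∧ N 3 0 = n ∧ (∀ b, 4 ≤ b → N b = 0) ∧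
        X 1 = 0 ∧ (∀ i < n, X 2 i = D i n) ∧ X 3 0 = ∑ i ∈ Finset.range n, D i n)
        (.seq (.ite (.rle (rvar 3) (.ofNat (.lit 0))) (.setR 3 (.lit 0) (.ofNat (.lit 1))) .skip)
          (.setN 3 (.lit 0) (.lit 0))) 15
        (fun N X => N 0 0 = n ∧ N 2 0 = m ∧ (∀ b, 3 ≤ b → N b 0 = 0) ∧
          (∀ b, 4 ≤ b → N b = 0) ∧ X 1 = 0 ∧
          (∀ i < n, X 2 i = D i n) ∧ 0 < X 3 0 ∧ ∑ i ∈ Finset.range n, D i n ≤ X 3 0 ∧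
          ((∑ i ∈ Finset.range n, D i n) = X 3 0 ∨ (∑ i ∈ Finset.range n, D i n) = 0)) := by
      have hs : 0 ≤ ∑ i ∈ Finset.range n, D i n :=
        Finset.sum_nonneg fun i hi => hD i (Finset.mem_range.1 hi)
      rintro ⟨N, X, τ⟩ ⟨h1, h2, h3, h4, h5, h6, h7⟩ σ' hσ'
      dsimp only at h1 h2 h3 h4 h5 h6 h7
      simp only [Prog.run] at hσ'
      have hN3 : ∀ b, 3 ≤ b → (if b = 3 ∧ 0 = 0 then 0 else N b 0) = 0 := fun b hb => by
        split_ifs with h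
        · rfl
        · rw [h4 b (by omega)]; rfl
      have hN4 : ∀ b, 4 ≤ b → (fun i => if b = 3 ∧ i = 0 then 0 else N b i) = 0 := fun b hb => by
        funext i
        simp [show b ≠ 3 by omega, h4 b hb]
      split_ifs at hσ' with htest
      · simp only [PMF.pure_bind, PMF.support_pure, Set.mem_singleton_iff] at hσ'
        subst hσ'
        simp only [Test.holds, RExpr.eval, NExpr.eval, h7, Nat.cast_zero] at htest
        have h0 : ∑ i ∈ Finset.range n, D i n = 0 := le_antisymm htest hs
        refine ⟨⟨?_, ?_, hN3, hN4, ?_, ?_, ?_, ?_, Or.inr h0⟩, ?_⟩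
        · simp [State.putR, State.putN, State.tick, h1]
        · simp [State.putR, State.putN, State.tick, h2]
        · funext i; simp [State.putR, State.putN, State.tick, h5]
        · intro i hi; simp [State.putR, State.putN, State.tick, h6 i hi]
        · simp [State.putR, State.putN, State.tick, NExpr.eval, RExpr.eval]
        · simp [State.putR, State.putN, State.tick, NExpr.eval, RExpr.eval, h0]
        · simp [State.putR, State.putN, State.tick, NExpr.cost, RExpr.cost, Test.cost]
      · simp only [PMF.pure_bind, PMF.support_pure, Set.mem_singleton_iff] at hσ'
        subst hσ'
        simp only [Test.holds, RExpr.eval, NExpr.eval, h7, Nat.cast_zero, not_le] at htest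
        refine ⟨⟨?_, ?_, hN3, hN4, h5, h6, ?_, ?_, Or.inl h7.symm⟩, ?_⟩
        · simp [State.putN, State.tick, h1]
        · simp [State.putN, State.tick, h2]
        · simpa [State.putN, State.tick, h7] using htest
        · simp [State.putN, State.tick, h7]
        · simp [State.putN, State.tick, NExpr.cost, RExpr.cost, Test.cost]
    refine (h1.seq h2).weaken (fun _ _ h => h) (fun _ _ h => h) ?_
    simp only [NExpr.cost]
    have : n * (T + 29 + 1) = n * (T + 30) := by ring
    omega
  · rintro t - ⟨N, X, τ⟩ ⟨h1, h2, h3, h4, h5, h6, h7⟩ σ' hσ'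
    dsimp only at h1 h2 h3 h4 h5 h6 h7
    simp only [Prog.run, PMF.pure_bind, PMF.support_pure, Set.mem_singleton_iff] at hσ'
    subst hσ'
    refine ⟨⟨?_, ?_, ?_, fun b hb => ?_, ?_, fun i hi => ?_, ?_⟩, ?_⟩
    · simp [State.putR, State.putN, State.tick, h1]
    · simp [State.putR, State.putN, State.tick, h2]
    · simp [State.putR, State.putN, State.tick, NExpr.eval, h3]
    · funext i; simp [State.putR, State.putN, State.tick, h4 b hb, show b ≠ 3 by omega]
    · funext i; simp [State.putR, State.putN, State.tick, h5]
    · simp [State.putR, State.putN, State.tick, NExpr.eval, h3, h1]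
      split_ifs with hit
      · rw [hit]
      · exact h6 i (by omega)
    · simp [State.putR, State.putN, State.tick, NExpr.eval, RExpr.eval, h3, h1, h7,
        Finset.sum_range_succ]
    · simp [State.putR, State.putN, State.tick, NExpr.cost, RExpr.cost]
      omega

end Deterministic

/-! ### Slots -/

section Slots

variable {D : ℕ → ℕ → ℝ} {T : ℕ}

/-- `M ≤ 2 * n` slots are owned by the points `i < n`. The slot `v` is owned by `o v`, and the point
`i` owns `k i` slots, which is at least its share with respect to the importances `a`. -/
structure IsSlots (n M : ℕ) (o k : ℕ → ℕ) (a : ℕ → ℝ) : Prop where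
  lt : ∀ v < M, o v < n
  pos : ∀ i < n, 1 ≤ k i
  sum : ∀ ψ : ℕ → ℝ,
    ∑ v ∈ Finset.range M, ψ (o v) = ∑ i ∈ Finset.range n, (k i : ℝ) * ψ i
  le : M ≤ 2 * n
  bound : ∀ i < n, M * a i ≤ 2 * (∑ j ∈ Finset.range n, a j) * k i

theorem IsSlots.pos_total {n M : ℕ} {o k : ℕ → ℕ} {a : ℕ → ℝ} (h : IsSlots n M o k a)
    (hn : 0 < n) : 0 < M := by
  by_contra! hM
  have h1 := h.sum (fun _ => 1)
  obtain rfl : M = 0 := by omega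
  have h2 : (0 : ℝ) < ∑ i ∈ Finset.range n, (k i : ℝ) * 1 :=
    Finset.sum_pos (fun i hi => by
      have := h.pos i (Finset.mem_range.1 hi)
      rw [mul_one]
      exact_mod_cast this) ⟨0, Finset.mem_range.2 hn⟩
  rw [← h1] at h2
  simp at h2

/-- The invariant of the slot assignment after `t` iterations. The current point is `i`. -/
structure SlotInvariant (n t : ℕ) (a : ℕ → ℝ) (A : ℝ) (i M : ℕ) (o k : ℕ → ℕ) : Prop where
  le : i ≤ n
  steps : i = n ∨ M = t
  lt : ∀ v < M, o v < n
  done : ∀ j < i, 1 ≤ k j ∧ n * a j ≤ k j * A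
  upper : ∀ j < n, k j * A ≤ n * a j + if j < i then A else 0
  sum : ∀ ψ : ℕ → ℝ,
    ∑ v ∈ Finset.range M, ψ (o v) = ∑ i ∈ Finset.range n, (k i : ℝ) * ψ i

variable {n t i M : ℕ} {a : ℕ → ℝ} {A : ℝ} {o k : ℕ → ℕ}

/-- Summing `upper` over all points: the shares n·a(j) add up to at most n·A, and rounding up costs
one extra A for each of the i finished points. -/
theorem SlotInvariant.total_le (h : SlotInvariant n t a A i M o k) (hA : 0 < A)
    (ha : ∑ j ∈ Finset.range n, a j ≤ A) : M ≤ n + i := by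
  have h1 := h.sum (fun _ => A)
  rw [Finset.sum_const, Finset.card_range, nsmul_eq_mul] at h1
  have h2 : (M : ℝ) * A ≤ (n + i : ℕ) * A := by
    rw [h1]
    refine (Finset.sum_le_sum fun j hj => h.upper j (Finset.mem_range.1 hj)).trans ?_
    rw [Finset.sum_add_distrib, ← Finset.mul_sum, ← Finset.sum_filter, Finset.sum_const,
      nsmul_eq_mul]
    have h3 : (Finset.range n).filter (· < i) = Finset.range i := by
      ext j
      have := h.le
      simp only [Finset.mem_filter, Finset.mem_range]
      omega
    rw [h3, Finset.card_range]
    push_cast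
    have : (n : ℝ) * ∑ j ∈ Finset.range n, a j ≤ n * A := by gcongr
    linarith
  exact_mod_cast le_of_mul_le_mul_right h2 hA

/-- After 2n iterations either i = n or M = 2n, and the latter also forces i = n by M ≤ n + i. So
every point is finished, and M·a(j) ≤ 2n·a(j) ≤ 2A·k(j). -/
theorem SlotInvariant.isSlots (h : SlotInvariant n (n + n) a A i M o k) (hA : 0 < A)
    (ha0 : ∀ j < n, 0 ≤ a j) (ha : ∑ j ∈ Finset.range n, a j ≤ A)
    (hA' : ∑ j ∈ Finset.range n, a j = A ∨ ∑ j ∈ Finset.range n, a j = 0) :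
    IsSlots n M o k a := by
  have hM := h.total_le hA ha
  have hle := h.le
  obtain rfl : i = n := by rcases h.steps with h1 | h1 <;> omega
  refine ⟨h.lt, fun j hj => (h.done j hj).1, h.sum, by omega, fun j hj => ?_⟩
  have hM' : (M : ℝ) ≤ 2 * i := by exact_mod_cast (by omega : M ≤ 2 * i)
  rcases hA' with hA' | hA'
  · rw [hA']
    calc (M : ℝ) * a j ≤ 2 * i * a j := by gcongr; exact ha0 j hj
      _ = 2 * (i * a j) := by ring
      _ ≤ 2 * (k j * A) := by have := (h.done j hj).2; gcongr
      _ = 2 * A * k j := by ring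
  · have := (Finset.sum_eq_zero_iff_of_nonneg fun j hj => ha0 j (Finset.mem_range.1 hj)).1 hA' j
      (Finset.mem_range.2 hj)
    rw [this, hA']
    simp

theorem sum_update {n i : ℕ} (hi : i < n) (f : ℕ → ℝ) (w : ℝ) (ψ : ℕ → ℝ) :
    ∑ j ∈ Finset.range n, (if j = i then f i + w else f j) * ψ j =
      ∑ j ∈ Finset.range n, f j * ψ j + w * ψ i := by
  have h : ∀ j, (if j = i then f i + w else f j) * ψ j =
      f j * ψ j + if j = i then w * ψ i else 0 := fun j => by
    split_ifs with h
    · rw [h]; ring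
    · ring
  simp only [h, Finset.sum_add_distrib, Finset.sum_ite_eq', Finset.mem_range, hi, if_true]

theorem SlotInvariant.step (h : SlotInvariant n t a A i M o k) (hi : i < n) {o' k' : ℕ → ℕ}
    (ho : ∀ v, o' v = if v = M then i else o v) (hk : ∀ j, k' j = if j = i then k i + 1 else k j)
    {i' : ℕ} (hi' : (n * a i ≤ k' i * A ∧ i' = i + 1) ∨ (k' i * A ≤ n * a i ∧ i' = i))
    (hA : 0 < A) :
    SlotInvariant n (t + 1) a A i' (M + 1) o' k' := by
  obtain ⟨h1, h2, h3, h4, h5, h6⟩ := h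
  have hki : k' i = k i + 1 := by rw [hk, if_pos rfl]
  have hkj : ∀ j, j ≠ i → k' j = k j := fun j hj => by rw [hk, if_neg hj]
  refine ⟨?_, Or.inr (by omega), fun v hv => ?_, fun j hj => ?_, fun j hj => ?_, fun ψ => ?_⟩
  · rcases hi' with ⟨-, rfl⟩ | ⟨-, rfl⟩ <;> omega
  · rw [ho]
    split_ifs with hvM
    · exact hi
    · exact h3 v (by omega)
  · by_cases hji : j = i
    · subst hji
      rcases hi' with ⟨h7, rfl⟩ | ⟨-, rfl⟩
      · exact ⟨by omega, h7⟩
      · omega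
    · rw [hkj j hji]
      exact h4 j (by rcases hi' with ⟨-, rfl⟩ | ⟨-, rfl⟩ <;> omega)
  · by_cases hji : j = i
    · subst hji
      have h7 := h5 j hj
      rw [if_neg (lt_irrefl _), add_zero] at h7
      -- Before the new slot the current point did not exceed its share, so finishing it overshoots
      -- by at most one A.
      rcases hi' with ⟨-, rfl⟩ | ⟨h8, rfl⟩
      · rw [if_pos (by omega), hki]
        push_cast
        linarith
      · rw [if_neg (lt_irrefl _), add_zero]
        exact h8
    · rw [hkj j hji]
      refine (h5 j hj).trans ?_
      gcongr
      split_ifs with h7 h8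
      · exact le_rfl
      · rcases hi' with ⟨-, rfl⟩ | ⟨-, rfl⟩ <;> omega
      · exact hA.le
      · exact le_rfl
  · have e : ∀ j, (k' j : ℝ) = if j = i then (k i : ℝ) + 1 else k j := fun j => by
      rw [hk]
      split_ifs <;> simp
    simp only [e]
    rw [Finset.sum_range_succ, sum_update hi (fun j => (k j : ℝ)) 1 ψ, ← h6, one_mul]
    congr 1
    · refine Finset.sum_congr rfl fun v hv => ?_
      rw [ho, if_neg (Finset.mem_range.1 hv).ne]
    · rw [ho, if_pos rfl]

theorem assignSlots_triple {n m : ℕ} (hD : ∀ i < n, 0 ≤ D i n) :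
    Triple D T (fun N X => N 0 0 = n ∧ N 2 0 = m ∧ (∀ b, 3 ≤ b → N b 0 = 0) ∧
        (∀ b, 4 ≤ b → N b = 0) ∧
        X 1 = 0 ∧ (∀ i < n, X 2 i = D i n) ∧ 0 < X 3 0 ∧ ∑ i ∈ Finset.range n, D i n ≤ X 3 0 ∧
        ((∑ i ∈ Finset.range n, D i n) = X 3 0 ∨ (∑ i ∈ Finset.range n, D i n) = 0))
      assignSlots (n * 96 + 6)
      (fun N X => N 2 0 = m ∧ X 1 = 0 ∧ IsSlots n (N 4 0) (N 5) (N 6) (fun i => D i n)) := by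
  refine (Triple.loop (m := n + n) (t := 47) (fun t N X => N 0 0 = n ∧ N 2 0 = m ∧
    X 1 = 0 ∧ (∀ i < n, X 2 i = D i n) ∧ (0 < X 3 0 ∧ ∑ i ∈ Finset.range n, D i n ≤ X 3 0 ∧
      ((∑ i ∈ Finset.range n, D i n) = X 3 0 ∨ (∑ i ∈ Finset.range n, D i n) = 0)) ∧
    SlotInvariant n t (fun i => D i n) (X 3 0) (N 3 0) (N 4 0) (N 5) (N 6))
    ?_ (fun σ h => by simp [NExpr.eval, h.1]) ?_).weaken
    (fun _ _ h => h) ?_ (by simp only [NExpr.cost]; omega)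
  · rintro N X ⟨h1, h2, h3, h4, h5, h6, h7⟩
    refine ⟨h1, h2, h5, h6, h7, ?_⟩
    rw [h3 3 le_rfl, h4 4 le_rfl, h4 5 (by omega), h4 6 (by omega)]
    refine ⟨by omega, Or.inr rfl, by simp, by simp, fun j hj => ?_, by simp⟩
    have := hD j hj
    simp only [Pi.zero_apply, Nat.cast_zero, zero_mul, not_lt_zero, if_false]
    positivity
  · rintro t - ⟨N, X, τ⟩ ⟨h1, h2, h3, h4, h5, h6⟩ σ' hσ'
    dsimp only at h1 h2 h3 h4 h5 h6
    simp only [slotBody, Prog.run, PMF.pure_bind] at hσ'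
    split_ifs at hσ' with hend htest
    · simp only [PMF.support_pure, Set.mem_singleton_iff] at hσ'
      subst hσ'
      simp only [Test.holds, NExpr.eval, h1] at hend
      -- An idle iteration: t grows while M does not, which the alternative i = n in `steps`
      -- permits.
      obtain ⟨b1, b2, b3, b4, b5, b6⟩ := h6
      refine ⟨⟨h1, h2, h3, h4, h5, b1, Or.inl (le_antisymm b1 hend), b3, b4, b5, b6⟩, ?_⟩
      simp [State.tick, NExpr.cost, Test.cost]
    · simp only [PMF.support_pure, Set.mem_singleton_iff] at hσ'
      subst hσ'
      simp only [Test.holds, NExpr.eval, h1, not_le] at hend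
      have h7 := h4 _ hend
      simp [Test.holds, State.putN, State.tick, NExpr.eval, RExpr.eval, h1, h7] at htest
      refine ⟨⟨?_, ?_, h3, h4, h5, ?_⟩, ?_⟩
      · simp [State.putN, State.tick, h1]
      · simp [State.putN, State.tick, h2]
      · simp only [State.putN, State.tick, NExpr.eval]
        refine h6.step (i' := N 3 0 + 1) hend (fun v => by simp) (fun j => by simp)
          (Or.inl ⟨by simpa using htest, by simp⟩) h5.1
      · simp [State.putN, State.tick, NExpr.cost, RExpr.cost, Test.cost]
    · simp only [PMF.support_pure, Set.mem_singleton_iff] at hσ'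
      subst hσ'
      simp only [Test.holds, NExpr.eval, h1, not_le] at hend
      have h7 := h4 _ hend
      simp [Test.holds, State.putN, State.tick, NExpr.eval, RExpr.eval, h1, h7] at htest
      refine ⟨⟨?_, ?_, h3, h4, h5, ?_⟩, ?_⟩
      · simp [State.putN, State.tick, h1]
      · simp [State.putN, State.tick, h2]
      · simp only [State.putN, State.tick, NExpr.eval]
        refine h6.step (i' := N 3 0) hend (fun v => by simp) (fun j => by simp)
          (Or.inr ⟨by simpa using htest.le, by simp⟩) h5.1
      · simp [State.putN, State.tick, NExpr.cost, RExpr.cost, Test.cost]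
  · rintro N X ⟨h1, h2, h3, h4, ⟨h5, h6, h7⟩, h8⟩
    exact ⟨h2, h3, h8.isSlots h5 hD h6 h7⟩

end Slots

/-! ### Sampling -/

section Sampling

open scoped ENNReal

variable {D : ℕ → ℕ → ℝ} {T : ℕ}

theorem sampleBody_run (σ : State) :
    sampleBody.run D T σ = (uniformBelow (σ.nat 4 0)).map (fun v =>
      ((σ.putN 7 0 v).putR 1 (σ.nat 5 v) (σ.real 1 (σ.nat 5 v) +
        σ.nat 4 0 / (σ.nat 2 0 * σ.nat 6 (σ.nat 5 v)))).tick 26) := by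
  rw [sampleBody, Prog.run, Prog.run, PMF.bind_map, PMF.map]
  congr 1

/-- The scalars and arrays that determine the distribution of the samples. -/
def Sampler (m M : ℕ) (o k : ℕ → ℕ) : Assertion := fun N _ =>
  N 2 0 = m ∧ N 4 0 = M ∧ N 5 = o ∧ N 6 = k

/-- The weighted sum of the values of `ψ`. -/
def weightedSum (n : ℕ) (X : ℕ → ℕ → ℝ) (ψ : ℕ → ℝ) : ℝ :=
  ∑ i ∈ Finset.range n, X 1 i * ψ i

theorem weightedSum_putR {n i : ℕ} (hi : i < n) (σ : State) (w : ℝ) (ψ : ℕ → ℝ) :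
    weightedSum n (σ.putR 1 i (σ.real 1 i + w)).real ψ =
      weightedSum n σ.real ψ + w * ψ i := by
  rw [weightedSum, weightedSum, ← sum_update hi (σ.real 1) w ψ]
  simp [State.putR]

/-- The properties of the weights after drawing `t` of `m` samples that hold with certainty. -/
structure SampleInvariant (n m M t : ℕ) (k : ℕ → ℕ) (X : ℕ → ℕ → ℝ) : Prop where
  nonneg : ∀ i < n, 0 ≤ X 1 i
  card : ((Finset.range n).filter (fun i => X 1 i ≠ 0)).card ≤ t
  sum : ∀ (ψ : ℕ → ℝ) (B : ℝ), (∀ i < n, M * ψ i ≤ B * k i) →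
    weightedSum n X ψ ≤ t * (B / m)

/-- A draw of owner i adds M·ψ(i)/(m·k(i)) ≤ B/m to the weighted sum, so m draws give at most B with
certainty. This later bounds the total weight by 2n and the weighted distances to c by 2A without
any probabilistic argument. -/
theorem sampling_triple {n m M : ℕ} {o k : ℕ → ℕ} {a : ℕ → ℝ} (h : IsSlots n M o k a)
    (hn : 0 < n) :
    Triple D T (fun N X => Sampler m M o k N X ∧ X 1 = 0) sampling (m * 27 + 3)
      (fun _ X => SampleInvariant n m M m k X) := by
  refine (Triple.loop (m := m) (t := 26) (fun t N X => Sampler m M o k N X ∧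
    SampleInvariant n m M t k X) ?_ (fun σ h => by simp [NExpr.eval, h.1.1]) ?_).weaken
    (fun _ _ h => h) (fun N X h => h.2) (by simp only [NExpr.cost]; omega)
  · rintro N X ⟨h1, h2⟩
    refine ⟨h1, by simp [h2], by simp [h2], fun ψ B _ => by simp [weightedSum, h2]⟩
  · rintro t htm σ ⟨⟨a1, a2, a3, a4⟩, b1, b2, b3⟩ σ' hσ'
    have hm : (0 : ℝ) < m := by exact_mod_cast (by omega : 0 < m)
    rw [sampleBody_run, a1, a2, a3, a4, PMF.support_map] at hσ'
    obtain ⟨v, hv, rfl⟩ := hσ'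
    have ho := h.lt v (support_uniformBelow (h.pos_total hn) hv)
    have hk : (0 : ℝ) < k (o v) := by exact_mod_cast h.pos _ ho
    refine ⟨⟨⟨?_, ?_, ?_, ?_⟩, fun i hi => ?_, ?_, fun ψ B hψ => ?_⟩, le_rfl⟩
    · simp [State.putN, State.putR, State.tick, a1]
    · simp [State.putN, State.putR, State.tick, a2]
    · funext j; simp [State.putN, State.putR, State.tick, a3]
    · funext j; simp [State.putN, State.putR, State.tick, a4]
    · simp only [State.putN, State.putR, State.tick, true_and]
      split_ifs with hio
      · have := b1 _ ho
        positivity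
      · exact b1 i hi
    · refine le_trans (Finset.card_le_card (t := insert (o v)
        ((Finset.range n).filter (fun i => σ.real 1 i ≠ 0))) ?_)
        ((Finset.card_insert_le _ _).trans (by omega))
      intro i hi
      simp only [State.putN, State.putR, State.tick, Finset.mem_filter, true_and,
        Finset.mem_insert] at hi ⊢
      by_cases hio : i = o v
      · exact Or.inl hio
      · rw [if_neg hio] at hi
        exact Or.inr hi
    · have e := weightedSum_putR ho (σ.putN 7 0 v) (M / (m * k (o v))) ψ
      refine (le_of_eq e).trans ?_
      have h1 : weightedSum n (σ.putN 7 0 v).real ψ ≤ t * (B / m) := b3 ψ B hψ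
      have h2 : (M : ℝ) / (m * k (o v)) * ψ (o v) ≤ B / m := by
        rw [div_mul_eq_mul_div, div_le_div_iff₀ (by positivity) hm]
        nlinarith [mul_le_mul_of_nonneg_left (hψ _ ho) hm.le]
      push_cast
      linarith

/-- The probability k(i)/M of drawing a slot of i cancels the weight M/(m·k(i)), so the mean
increment is 1/m of the true sum; `hφ` bounds each increment by B/m. Hoeffding's lemma then gives
the factor. -/
theorem expect_sampleBody_le {n m M : ℕ} {o k : ℕ → ℕ} {a : ℕ → ℝ} (h : IsSlots n M o k a)
    (hn : 0 < n) (hm : 0 < m) {φ : ℕ → ℝ} {B : ℝ} (hφ : ∀ i < n, M * |φ i| ≤ B * k i)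
    (lam : ℝ) (σ : State) (hσ : Sampler m M o k σ.nat σ.real) :
    expect (sampleBody.run D T σ)
        (fun τ => ENNReal.ofReal (Real.exp (lam * weightedSum n τ.real φ))) ≤
      ENNReal.ofReal (Real.exp (lam * (∑ i ∈ Finset.range n, φ i) / m +
        2 * (|lam| * B / m) ^ 2)) *
        ENNReal.ofReal (Real.exp (lam * weightedSum n σ.real φ)) := by
  obtain ⟨a1, a2, a3, a4⟩ := hσ
  have hM := h.pos_total hn
  have hM' : (0 : ℝ) < M := by exact_mod_cast hM
  have hm' : (0 : ℝ) < m := by exact_mod_cast hm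
  rw [sampleBody_run, a1, a2, a3, a4, expect_map]
  set z : ℕ → ℝ := fun v => lam * (M / (m * k (o v)) * φ (o v)) with hz
  have hexp : expect (uniformBelow M) (fun v => ENNReal.ofReal (Real.exp (lam * weightedSum n
      (((σ.putN 7 0 v).putR 1 (o v) (σ.real 1 (o v) + M / (m * k (o v)))).tick 26).real φ))) ≤
      expect (uniformBelow M) (fun v => ENNReal.ofReal (Real.exp (lam * weightedSum n σ.real φ)) *
        ENNReal.ofReal (Real.exp (z v))) := by
    refine expect_mono fun v hv => ?_
    have e := weightedSum_putR (h.lt v (support_uniformBelow hM hv)) (σ.putN 7 0 v)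
      (M / (m * k (o v))) φ
    rw [← ENNReal.ofReal_mul (Real.exp_pos _).le, ← Real.exp_add, hz]
    refine le_of_eq ?_
    congr 2
    refine (congrArg (lam * ·) e).trans ?_
    simp only [State.putN]
    ring
  refine hexp.trans ?_
  rw [expect_const_mul, mul_comm, expect_uniformBelow hM _ (fun v => (Real.exp_pos _).le)]
  gcongr
  refine sum_exp_div_le hM (fun v hv => ?_) ?_
  · have ho := h.lt v hv
    have hk : (0 : ℝ) < k (o v) := by exact_mod_cast h.pos _ ho
    have h1 := hφ _ ho
    simp only [hz]
    rw [abs_mul, mul_div_assoc, abs_mul, abs_of_pos (by positivity : 0 < (M : ℝ) / (m * k (o v)))]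
    gcongr
    rw [div_mul_eq_mul_div, div_le_div_iff₀ (by positivity) hm']
    nlinarith [mul_le_mul_of_nonneg_left h1 hm'.le]
  · have h1 := h.sum (fun i => lam * (M / (m * k i) * φ i))
    rw [h1, Finset.mul_sum, Finset.sum_div, Finset.mul_sum]
    refine Finset.sum_congr rfl fun i hi => ?_
    have hk : (k i : ℝ) ≠ 0 := by
      have := h.pos i (Finset.mem_range.1 hi)
      exact_mod_cast (by omega : k i ≠ 0)
    field_simp

theorem sampler_preserved {m M : ℕ} {o k : ℕ → ℕ} (σ : State)
    (hσ : Sampler m M o k σ.nat σ.real) (σ' : State) (hσ' : σ' ∈ (sampleBody.run D T σ).support) :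
    Sampler m M o k σ'.nat σ'.real := by
  obtain ⟨a1, a2, a3, a4⟩ := hσ
  rw [sampleBody_run, PMF.support_map] at hσ'
  obtain ⟨v, -, rfl⟩ := hσ'
  refine ⟨?_, ?_, ?_, ?_⟩
  · simp [State.putN, State.putR, State.tick, a1]
  · simp [State.putN, State.putR, State.tick, a2]
  · funext j; simp [State.putN, State.putR, State.tick, a3]
  · funext j; simp [State.putN, State.putR, State.tick, a4]

/-- Hoeffding's inequality for the weights drawn by the algorithm. -/
theorem sampling_tail {n m M : ℕ} {o k : ℕ → ℕ} {a : ℕ → ℝ} (h : IsSlots n M o k a)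
    (hn : 0 < n) (hm : 0 < m) {φ : ℕ → ℝ} {B η : ℝ} (hη : 0 < η)
    (hφ : ∀ i < n, M * |φ i| ≤ B * k i) (σ : State) (hσ : Sampler m M o k σ.nat σ.real)
    (hσ1 : σ.real 1 = 0) :
    (sampling.run D T σ).toOuterMeasure
        {τ | ∑ i ∈ Finset.range n, φ i + η * B < weightedSum n τ.real φ} ≤
      ENNReal.ofReal (Real.exp (-(m * η ^ 2 / 8))) := by
  have hM := h.pos_total hn
  have hM' : (0 : ℝ) < M := by exact_mod_cast hM
  have hm' : (0 : ℝ) < m := by exact_mod_cast hm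
  have hk0 : (0 : ℝ) < k 0 := by exact_mod_cast h.pos 0 hn
  have hB : 0 ≤ B := by
    by_contra! hB
    have h1 := hφ 0 hn
    have h2 : 0 ≤ M * |φ 0| := by positivity
    nlinarith
  -- For B = 0 the function φ vanishes and the event is empty; the choice of `lam` below divides by
  -- B.
  rcases hB.eq_or_lt with rfl | hB
  · have h0 : ∀ i ∈ Finset.range n, φ i = 0 := fun i hi => by
      have h1 := hφ i (Finset.mem_range.1 hi)
      rw [zero_mul] at h1
      have h2 := abs_nonneg (φ i)
      have h3 : |φ i| ≤ 0 := by
        by_contra! h3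
        have : 0 < M * |φ i| := by positivity
        linarith
      exact abs_nonpos_iff.1 h3
    have e : {τ : State | ∑ i ∈ Finset.range n, φ i + η * 0 < weightedSum n τ.real φ} = ∅ := by
      ext τ
      simp only [Set.mem_ofPred_eq, Set.mem_empty_iff_false, iff_false, not_lt, weightedSum]
      rw [Finset.sum_eq_zero h0, Finset.sum_eq_zero fun i hi => by rw [h0 i hi, mul_zero]]
      simp
    rw [e]
    simp
  -- The minimizer of -lam·η·B + 2·lam²·B²/m, with minimum -m·η²/8.
  set lam : ℝ := m * η / (4 * B) with hlam
  have hlam0 : 0 < lam := by positivity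
  set S := ∑ i ∈ Finset.range n, φ i with hS
  have h1 := expect_iterate_le (f := sampleBody.run D T) (J := Sampler m M o k)
    (h := fun τ => ENNReal.ofReal (Real.exp (lam * weightedSum n τ.real φ)))
    sampler_preserved
    (fun τ hτ => expect_sampleBody_le h hn hm hφ lam τ hτ) (fun _ _ => rfl) m
    (σ.tick ((nvar 2).cost + 1)) hσ
  have hrun : sampling.run D T σ = iterate (sampleBody.run D T) m (σ.tick ((nvar 2).cost + 1)) := by
    rw [sampling, Prog.run]
    congr 1
    exact hσ.1
  have h2 : weightedSum n (σ.tick ((nvar 2).cost + 1)).real φ = 0 := by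
    simp [weightedSum, State.tick, hσ1]
  rw [h2, mul_zero, Real.exp_zero, ENNReal.ofReal_one, mul_one,
    ← ENNReal.ofReal_pow (Real.exp_pos _).le, ← Real.exp_nat_mul] at h1
  rw [hrun]
  refine (toOuterMeasure_le_expect _ _ (fun τ => ENNReal.ofReal (Real.exp (-(lam * (S + η * B)))) *
    ENNReal.ofReal (Real.exp (lam * weightedSum n τ.real φ))) fun τ hτ => ?_).trans ?_
  · rw [← ENNReal.ofReal_mul (Real.exp_pos _).le, ← Real.exp_add, ENNReal.one_le_ofReal,
      Real.one_le_exp_iff]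
    have h3 : S + η * B < weightedSum n τ.real φ := hτ
    have h4 := mul_lt_mul_of_pos_left h3 hlam0
    linarith
  · rw [expect_const_mul]
    refine (mul_le_mul_right h1 _).trans ?_
    rw [← ENNReal.ofReal_mul (Real.exp_pos _).le, ← Real.exp_add]
    refine ENNReal.ofReal_le_ofReal (Real.exp_le_exp.2 (le_of_eq ?_))
    rw [abs_of_pos hlam0, hlam]
    field_simp
    ring

end Sampling

/-! ### Analysis of the algorithm -/

section Analysis

open scoped ENNReal

variable {D : ℕ → ℕ → ℝ} {T : ℕ}

theorem coresetProg_triple {n d ℓ : ℕ} {p ε δ : ℝ} (hn : 0 < n) (hD : ∀ i < n, 0 ≤ D i n) :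
    Triple D T (fun N X => N = (input n d ℓ p ε δ).nat ∧ X = (input n d ℓ p ε δ).real)
      coresetProg (n * (T + 216) + 89)
      (fun _ X => (∀ i < n, 0 ≤ X 1 i) ∧ ∃ m L₁ L₂, IsLog n ε L₁ ∧ IsLog n δ L₂ ∧
        IsRounded n (512 / (ε * ε) * (d * ℓ * (8 + (L₁ + L₁)) + L₂)) m ∧
        ((Finset.range n).filter (fun i => X 1 i ≠ 0)).card ≤ m) := by
  intro σ hσ σ' hσ'
  rw [coresetProg, Prog.run, PMF.mem_support_bind_iff] at hσ'
  obtain ⟨ρ, hρ, hσ'⟩ := hσ'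
  obtain ⟨⟨a1, a2, a3, a4, L₁, L₂, hL₁, hL₂, hm⟩, ht⟩ :=
    sampleSize_triple (D := D) (T := T) σ hσ ρ hρ
  have hexp : n * (T + 216) = n * (T + 30) + 186 * n := by ring
  rw [Prog.run] at hσ'
  simp only [Test.holds, NExpr.eval, a1, Test.cost, NExpr.cost] at hσ'
  split_ifs at hσ' with htest
  · obtain ⟨b1, b2⟩ := outputAll_triple (D := D) (T := T) (n := n) (ρ.tick _)
      ⟨a1, by simp [State.tick, a2 3 le_rfl]⟩ σ' hσ'
    refine ⟨⟨fun i hi => by rw [b1 i hi]; exact zero_le_one, _, L₁, L₂, hL₁, hL₂, hm, ?_⟩, ?_⟩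
    · refine (Finset.card_filter_le _ _).trans ?_
      rwa [Finset.card_range]
    · simp only [State.tick] at b2
      omega
  · rw [Prog.run, PMF.mem_support_bind_iff] at hσ'
    obtain ⟨τ, hτ, hσ'⟩ := hσ'
    obtain ⟨⟨b1, b2, b3⟩, b4⟩ := (distances_triple (T := T) (m := ρ.nat 2 0) hD).seq
      (assignSlots_triple hD) (ρ.tick _) ⟨a1, rfl, a2, a3, a4⟩ τ hτ
    obtain ⟨c1, c2⟩ := sampling_triple (D := D) (T := T) (m := ρ.nat 2 0) b3 hn τ
      ⟨⟨b1, rfl, rfl, rfl⟩, b2⟩ σ' hσ'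
    refine ⟨⟨c1.nonneg, _, L₁, L₂, hL₁, hL₂, hm, c1.card⟩, ?_⟩
    simp only [State.tick] at b4
    omega

/-- To bound the probability of an event, it suffices to consider the sampling phase. -/
theorem coresetProg_toOuterMeasure_le {n d ℓ : ℕ} {p ε δ : ℝ} (hD : ∀ i < n, 0 ≤ D i n)
    {bad : Set State} {K : ℝ≥0∞} (hall : ∀ τ : State, (∀ i < n, τ.real 1 i = 1) → τ ∉ bad)
    (hsamp : ∀ m M o k L₁ L₂, IsLog n ε L₁ → IsLog n δ L₂ →
      IsRounded n (512 / (ε * ε) * (d * ℓ * (8 + (L₁ + L₁)) + L₂)) m → m < n →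
      IsSlots n M o k (fun i => D i n) → ∀ ρ : State, Sampler m M o k ρ.nat ρ.real →
      ρ.real 1 = 0 → (sampling.run D T ρ).toOuterMeasure bad ≤ K) :
    (coresetProg.run D T (input n d ℓ p ε δ)).toOuterMeasure bad ≤ K := by
  rw [coresetProg, Prog.run]
  refine toOuterMeasure_bind_le fun ρ hρ => ?_
  obtain ⟨⟨a1, a2, a3, a4, L₁, L₂, hL₁, hL₂, hm⟩, -⟩ :=
    sampleSize_triple (D := D) (T := T) (input n d ℓ p ε δ) ⟨rfl, rfl⟩ ρ hρ
  rw [Prog.run]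
  simp only [Test.holds, NExpr.eval, a1, Test.cost, NExpr.cost]
  split_ifs with htest
  · refine le_trans (toOuterMeasure_le_of_support (t := ∅) fun τ hτ hbad => ?_) (by simp)
    exact hall τ (outputAll_triple (D := D) (T := T) (n := n) (ρ.tick _)
      ⟨a1, by simp [State.tick, a2 3 le_rfl]⟩ τ hτ).1 hbad
  · rw [Prog.run]
    refine toOuterMeasure_bind_le fun τ hτ => ?_
    obtain ⟨⟨b1, b2, b3⟩, b4⟩ := (distances_triple (T := T) (m := ρ.nat 2 0) hD).seq
      (assignSlots_triple hD) (ρ.tick _) ⟨a1, rfl, a2, a3, a4⟩ τ hτ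
    exact hsamp _ _ _ _ L₁ L₂ hL₁ hL₂ hm (not_le.1 htest) b3 τ ⟨b1, rfl, rfl, rfl⟩ b2

/-! ### Estimates for the number of samples -/

/-- The last doubling started from a product at most 1, so (k - 1)·log 2 ≤ log(1/x); the factor 2
comes from log 2 > 1/2. -/
theorem IsLog.le {n : ℕ} {x L : ℝ} (h : IsLog n x L) (hx : 0 < x) (hx1 : x ≤ 1) :
    L ≤ 1 + 2 * Real.log (1 / x) := by
  obtain ⟨k, rfl, -, h⟩ := h
  have h0 : 0 ≤ Real.log (1 / x) := Real.log_nonneg (by rw [le_div_iff₀ hx]; linarith)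
  rcases h with rfl | h
  · push_cast
    linarith
  · have h1 : Real.log (2 ^ k * x) ≤ Real.log 2 := Real.log_le_log (by positivity) h
    rw [Real.log_mul (by positivity) hx.ne', Real.log_pow] at h1
    rw [one_div, Real.log_inv] at h0 ⊢
    have h2 := Real.log_two_gt_d9
    rcases Nat.eq_zero_or_pos k with rfl | hk
    · push_cast
      linarith
    · have : (1 : ℝ) ≤ k := by exact_mod_cast hk
      nlinarith

/-- Below the cap, 2^k·x > 1, and 2 ≤ e allows the change of base. -/
theorem IsLog.exp_neg_le {n : ℕ} {x L : ℝ} (h : IsLog n x L) (hx : 0 < x) (hL : L < n) :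
    Real.exp (-L) ≤ x := by
  obtain ⟨k, rfl, h, -⟩ := h
  have hk : k ≠ n := by
    have : k < n := by exact_mod_cast hL
    omega
  have h1 : (2 : ℝ) ^ k ≤ Real.exp k := by
    rw [← Real.exp_one_pow]
    exact pow_le_pow_left₀ (by norm_num) (by linarith [Real.add_one_le_exp 1]) k
  have h2 := h.resolve_left hk
  rw [Real.exp_neg, inv_le_iff_one_le_mul₀ (Real.exp_pos _)]
  nlinarith

theorem IsLog.nonneg {n : ℕ} {x L : ℝ} (h : IsLog n x L) : 0 ≤ L := by
  obtain ⟨k, rfl, -⟩ := h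
  positivity

theorem sampleCount_le {n d ℓ m : ℕ} {ε δ L₁ L₂ : ℝ} (hd : 1 ≤ d) (hℓ : 1 ≤ ℓ) (hε : 0 < ε)
    (hε1 : ε < 1) (hδ : 0 < δ) (hδ1 : δ < 1) (h₁ : IsLog n ε L₁) (h₂ : IsLog n δ L₂)
    (hm : IsRounded n (512 / (ε * ε) * (d * ℓ * (8 + (L₁ + L₁)) + L₂)) m) :
    (m : ℝ) ≤ softBound 6144 1 (ε⁻¹ ^ 2 * d * ℓ) * (1 + Real.log (1 / δ)) := by
  have hu := h₁.le hε hε1.le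
  have hv := h₂.le hδ hδ1.le
  have hu0 : 0 ≤ Real.log (1 / ε) := Real.log_nonneg (by rw [le_div_iff₀ hε]; linarith)
  have hv0 : 0 ≤ Real.log (1 / δ) := Real.log_nonneg (by rw [le_div_iff₀ hδ]; linarith)
  set u := Real.log (1 / ε) with hu'
  set v := Real.log (1 / δ)
  have hd' : (1 : ℝ) ≤ d := by exact_mod_cast hd
  have hℓ' : (1 : ℝ) ≤ ℓ := by exact_mod_cast hℓ
  have hdℓ : (1 : ℝ) ≤ d * ℓ := by nlinarith
  have he1 : 1 ≤ ε⁻¹ ^ 2 := one_le_pow₀ ((one_le_inv₀ hε).2 hε1.le)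
  set f := ε⁻¹ ^ 2 * d * ℓ with hf
  have hf1 : ε⁻¹ ^ 2 ≤ f := by
    rw [hf, mul_assoc]
    exact le_mul_of_one_le_right (by positivity) hdℓ
  have hF : 2 * u ≤ Real.log f := by
    have : Real.log (ε⁻¹ ^ 2) = 2 * u := by
      rw [Real.log_pow, hu', one_div]
      norm_num
    rw [← this]
    exact Real.log_le_log (by positivity) hf1
  set F := Real.log f
  have hF0 : 0 ≤ F := by linarith
  have hf0 : 0 ≤ f := by positivity
  -- The left side is at most 512·f·(11 + 2F + 2v) + 1. As f ≥ 1, the factor 12·512 = 6144 absorbs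
  -- the rounding term 1.
  have key : 512 / (ε * ε) * (d * ℓ * (8 + (L₁ + L₁)) + L₂) + 1 ≤
      6144 * f * (1 + F) ^ 1 * (1 + v) := by
    have e : 512 / (ε * ε) * (d * ℓ * (8 + (L₁ + L₁)) + L₂) =
        512 * (f * (8 + (L₁ + L₁)) + ε⁻¹ ^ 2 * L₂) := by
      rw [hf]
      field_simp
    have e1 : f * (8 + (L₁ + L₁)) ≤ f * (10 + 2 * F) := by
      exact mul_le_mul_of_nonneg_left (by linarith) hf0
    have e2 : ε⁻¹ ^ 2 * L₂ ≤ f * (1 + 2 * v) := by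
      refine mul_le_mul hf1 hv h₂.nonneg (by positivity)
    have e3 : 0 ≤ f * (F * v) := by positivity
    have e4 : 0 ≤ f * F := by positivity
    have e5 : 0 ≤ f * v := by positivity
    rw [e, pow_one]
    nlinarith
  rcases hm.2 with h0 | h0
  · rw [h0, Nat.cast_zero]
    unfold softBound
    positivity
  · exact h0.trans key

/-- The union bound has 2 tails for the count and 2 for each of the K net points. The exponent is
mε²/512 ≥ G: its part dℓ(8 + 2L₁) pays for the net and its part L₂ for δ. -/
theorem failure_le {n d ℓ m K : ℕ} {ε δ L₁ L₂ : ℝ} (hd : 1 ≤ d) (hℓ : 1 ≤ ℓ) (hε : 0 < ε)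
    (hε1 : ε < 1) (hδ : 0 < δ) (h₁ : IsLog n ε L₁) (h₂ : IsLog n δ L₂)
    (hm : IsRounded n (512 / (ε * ε) * (d * ℓ * (8 + (L₁ + L₁)) + L₂)) m) (hmn : m < n)
    (hK : (K : ℝ) ≤ (289 / ε ^ 2) ^ (d * ℓ)) :
    (2 + K * 2) * Real.exp (-(m * (ε / 8) ^ 2 / 8)) ≤ δ := by
  have hd' : (1 : ℝ) ≤ d := by exact_mod_cast hd
  have hℓ' : (1 : ℝ) ≤ ℓ := by exact_mod_cast hℓ
  have hdℓ : (1 : ℝ) ≤ d * ℓ := by nlinarith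
  have hL₁ := h₁.nonneg
  have hL₂ := h₂.nonneg
  set G : ℝ := d * ℓ * (8 + (L₁ + L₁)) + L₂ with hG
  have hGL : 8 + (L₁ + L₁) + L₂ ≤ G := by rw [hG]; nlinarith
  have hx := hm.1.resolve_left hmn.ne
  have hGm : G ≤ m * ε ^ 2 / 512 := by
    rw [le_div_iff₀ (by norm_num)]
    rw [div_mul_eq_mul_div, div_le_iff₀ (by positivity)] at hx
    linarith
  have hmn' : (m : ℝ) < n := by exact_mod_cast hmn
  have hε2 : ε ^ 2 ≤ 1 := pow_le_one₀ hε.le hε1.le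
  have hm0 : (0 : ℝ) ≤ m := by positivity
  -- This keeps L₁ and L₂ below the cap n, so that they are true logarithms.
  have hGn : G < n := by nlinarith
  have e1 := h₁.exp_neg_le hε (by linarith)
  have e2 := h₂.exp_neg_le hδ (by linarith)
  have hq : 1 ≤ 289 / ε ^ 2 := by rw [le_div_iff₀ (by positivity)]; linarith
  have hK' : (2 + K * 2 : ℝ) ≤ Real.exp ((8 + (L₁ + L₁)) * (d * ℓ)) := by
    have b1 : (2 + K * 2 : ℝ) ≤ 4 * (289 / ε ^ 2) ^ (d * ℓ) := by
      have := one_le_pow₀ hq (n := d * ℓ)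
      linarith
    have b2 : (4 : ℝ) ≤ 4 ^ (d * ℓ) := by
      have h1 : 1 ≤ d * ℓ := by exact_mod_cast hdℓ
      exact le_self_pow₀ (by norm_num) (by omega)
    -- Origin of the 8 in the sample size: 4·289 = 1156 ≤ e⁸.
    have b3 : 4 * (289 / ε ^ 2) ≤ Real.exp (8 + (L₁ + L₁)) := by
      have c1 : (2.7 : ℝ) ^ 8 ≤ Real.exp 1 ^ 8 :=
        pow_le_pow_left₀ (by norm_num) (by linarith [Real.exp_one_gt_d9]) 8
      rw [Real.exp_one_pow] at c1
      push_cast at c1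
      have c2 : 1 / ε ≤ Real.exp L₁ := by
        rw [Real.exp_neg] at e1
        rw [one_div]
        exact inv_le_of_inv_le₀ (Real.exp_pos _) e1
      have c3 : (1 / ε) * (1 / ε) ≤ Real.exp L₁ * Real.exp L₁ := by gcongr
      rw [Real.exp_add, Real.exp_add]
      calc 4 * (289 / ε ^ 2) = 1156 * (1 / ε * (1 / ε)) := by field_simp; norm_num
        _ ≤ Real.exp 8 * (Real.exp L₁ * Real.exp L₁) := by
          gcongr
          refine le_trans ?_ c1
          norm_num
    calc (2 + K * 2 : ℝ) ≤ 4 ^ (d * ℓ) * (289 / ε ^ 2) ^ (d * ℓ) := by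
          refine b1.trans ?_
          gcongr
      _ = (4 * (289 / ε ^ 2)) ^ (d * ℓ) := (mul_pow _ _ _).symm
      _ ≤ Real.exp (8 + (L₁ + L₁)) ^ (d * ℓ) := by gcongr
      _ = Real.exp ((8 + (L₁ + L₁)) * (d * ℓ)) := by
          rw [← Real.exp_nat_mul]
          push_cast
          ring_nf
  calc (2 + K * 2) * Real.exp (-(m * (ε / 8) ^ 2 / 8))
      ≤ Real.exp ((8 + (L₁ + L₁)) * (d * ℓ)) * Real.exp (-G) := by
        gcongr
        linarith
    _ = Real.exp (-L₂) := by
        rw [← Real.exp_add, hG]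
        ring_nf
    _ ≤ δ := e2

end Analysis

/-! ### Indexed form of the objective -/

section Node

variable {Y : Type*} {P : Finset Y} (pt : Fin P.card ≃ P) (c : Y)

/-- The point with index `i`, as seen by the oracle. -/
def node (i : ℕ) : Y :=
  if h : i < P.card then (pt ⟨i, h⟩ : Y) else c

theorem sum_eq_sum_node {β : Type*} [AddCommMonoid β] (g : Y → β) :
    ∑ x ∈ P, g x = ∑ i ∈ Finset.range P.card, g (node pt c i) := by
  rw [← Fin.sum_univ_eq_sum_range (fun i => g (node pt c i)), ← Finset.sum_coe_sort,
    ← Equiv.sum_comp pt]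
  refine Finset.sum_congr rfl fun i _ => ?_
  simp [node]

theorem outWeight_node (σ : State) {i : ℕ} (hi : i < P.card) :
    outWeight pt σ (node pt c i) = σ.real 1 i := by
  simp [outWeight, node, hi]

theorem card_outSet (c : Y) (σ : State) :
    (outSet pt σ).card = ((Finset.range P.card).filter (fun i => σ.real 1 i ≠ 0)).card := by
  unfold outSet
  rw [Finset.card_filter, Finset.card_filter, sum_eq_sum_node pt c]
  refine Finset.sum_congr rfl fun i hi => ?_
  rw [outWeight_node pt c σ (Finset.mem_range.1 hi)]

theorem isWeightedSubset_outSet {σ : State} (h : ∀ i < P.card, 0 ≤ σ.real 1 i) :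
    IsWeightedSubset P (outSet pt σ) (outWeight pt σ) := by
  refine ⟨Finset.filter_subset _ _, fun x _ => ?_⟩
  unfold outWeight
  split_ifs with hx
  · exact h _ (pt.symm ⟨x, hx⟩).2
  · exact le_rfl

end Node

/-! ### Reduction of the coreset inequality to a net of centers. -/

section Indexed

variable {X : Type*} [MetricSpace X] {ℓ : ℕ} {p : ℝ} {P : Finset (Fin ℓ → X)}
  (pt : Fin P.card ≃ P) (c : Fin ℓ → X)

theorem costWS_outSet (σ : State) (s : Fin ℓ → X) :
    costWS p (outSet pt σ) (outWeight pt σ) s =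
      weightedSum P.card σ.real (fun i => dWS p (node pt c i) s) := by
  unfold costWS outSet weightedSum
  rw [Finset.sum_filter_of_ne (fun x _ h => left_ne_zero_of_mul h), sum_eq_sum_node pt c]
  refine Finset.sum_congr rfl fun i hi => ?_
  rw [outWeight_node pt c σ (Finset.mem_range.1 hi)]

theorem costWS_nonneg (p : ℝ) (s : Fin ℓ → X) : 0 ≤ costWS p P (fun _ => 1) s :=
  Finset.sum_nonneg fun x _ => mul_nonneg zero_le_one (dWS_nonneg x s)

theorem costWS_one (s : Fin ℓ → X) :
    costWS p P (fun _ => 1) s = ∑ i ∈ Finset.range P.card, dWS p (node pt c i) s := by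
  unfold costWS
  rw [sum_eq_sum_node pt c]
  simp only [one_mul]

/-- The difference of the distances of a data point and of the center `c` to `s`. -/
def excess (p : ℝ) (s : Fin ℓ → X) (i : ℕ) : ℝ :=
  dWS p (node pt c i) s - dWS p c s

/-- The bound is uniform in s; this is why sampling by the distance to c works for all centers. -/
theorem abs_excess_le (hp : 1 ≤ p) (s : Fin ℓ → X) (i : ℕ) :
    |excess pt c p s i| ≤ dWS p (node pt c i) c := by
  have h1 := dWS_triangle hp (node pt c i) c s
  have h2 := dWS_triangle hp c (node pt c i) s
  rw [dWS_comm hp c (node pt c i)] at h2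
  unfold excess
  rw [abs_le]
  constructor <;> linarith

theorem weightedSum_const_mul (n : ℕ) (Y : ℕ → ℕ → ℝ) (ψ : ℕ → ℝ) (r : ℝ) :
    weightedSum n Y (fun i => r * ψ i) = r * weightedSum n Y ψ := by
  unfold weightedSum
  rw [Finset.mul_sum]
  exact Finset.sum_congr rfl fun i _ => by ring

theorem weightedSum_dWS (Y : ℕ → ℕ → ℝ) (n : ℕ) (s : Fin ℓ → X) :
    weightedSum n Y (fun i => dWS p (node pt c i) s) =
      weightedSum n Y (excess pt c p s) + weightedSum n Y (fun _ => 1) * dWS p c s := by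
  unfold weightedSum excess
  rw [Finset.sum_mul, ← Finset.sum_add_distrib]
  exact Finset.sum_congr rfl fun i _ => by ring

/-- Weights that estimate the number of points and the total excess for all `t` in a net
form a coreset. -/
theorem isCoreset_of_net (hp : 1 ≤ p) {ε : ℝ} (hε : 0 < ε) (hε1 : ε < 1) (hP : P.Nonempty)
    {σ : State} (hw : ∀ i < P.card, 0 ≤ σ.real 1 i) {A : ℝ} (hA : A = costWS p P (fun _ => 1) c)
    {N : Finset (Fin ℓ → X)}
    (hN : ∀ s, dWS p c s * (ε * P.card) < 6 * A →
      ∃ t ∈ N, ∀ x, |dWS p x s - dWS p x t| * (24 * P.card) ≤ ε * A)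
    (hone : weightedSum P.card σ.real (fun _ => 1) ≤ 2 * P.card)
    (hdist : weightedSum P.card σ.real (fun i => dWS p (node pt c i) c) ≤ 2 * A)
    (htotal : |weightedSum P.card σ.real (fun _ => 1) - P.card| ≤ ε / 4 * P.card)
    (hnet : ∀ t ∈ N, |weightedSum P.card σ.real (excess pt c p t) -
      ∑ i ∈ Finset.range P.card, excess pt c p t i| ≤ ε / 4 * A) :
    IsCoreset p ε (costWS p P (fun _ => 1) c) P (outSet pt σ) (outWeight pt σ) := by
  refine ⟨isWeightedSubset_outSet pt hw, fun s => ?_⟩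
  rw [← hA]
  have hn : (0 : ℝ) < P.card := by exact_mod_cast hP.card_pos
  have hA0 : 0 ≤ A := hA ▸ costWS_nonneg p c
  have hA' : A = ∑ i ∈ Finset.range P.card, dWS p (node pt c i) c := by rw [hA, costWS_one pt c]
  have hr := dWS_nonneg (p := p) c s
  set r := dWS p c s with hr'
  set Φ := ∑ i ∈ Finset.range P.card, excess pt c p s i with hΦ
  set W := weightedSum P.card σ.real (excess pt c p s) with hW
  have hcostP : costWS p P (fun _ => 1) s = Φ + P.card * r := by
    rw [costWS_one pt c, hΦ]
    unfold excess
    rw [Finset.sum_sub_distrib]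
    simp [hr']
  have hΦA : |Φ| ≤ A := by
    rw [hA']
    exact (Finset.abs_sum_le_sum_abs _ _).trans
      (Finset.sum_le_sum fun i _ => abs_excess_le pt c hp s i)
  have hWA : |W| ≤ 2 * A := by
    refine le_trans ?_ hdist
    refine (Finset.abs_sum_le_sum_abs _ _).trans (Finset.sum_le_sum fun i hi => ?_)
    rw [abs_mul, abs_of_nonneg (hw i (Finset.mem_range.1 hi))]
    exact mul_le_mul_of_nonneg_left (abs_excess_le pt c hp s i) (hw i (Finset.mem_range.1 hi))
  have hnr : P.card * r ≤ costWS p P (fun _ => 1) s + A := by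
    rw [hcostP]
    linarith [(abs_le.1 hΦA).1]
  rw [costWS_outSet pt c, weightedSum_dWS, ← hW, ← hr']
  set w := weightedSum P.card σ.real (fun _ => 1) with hw'
  have hwr : |(w - P.card) * r| ≤ ε / 4 * (P.card * r) := by
    rw [abs_mul, abs_of_nonneg hr]
    nlinarith
  have hmain : |Φ - W| ≤ ε / 2 * (costWS p P (fun _ => 1) s + A) := by
    have hcost0 := costWS_nonneg (P := P) p s
    -- The product form avoids dividing by A; for A = 0 every s counts as far.
    by_cases hfar : r * (ε * P.card) < 6 * A
    · obtain ⟨t, ht, hst⟩ := hN s hfar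
      have h1 := abs_le.1 (hnet t ht)
      have hη : ∀ x, |dWS p x s - dWS p x t| ≤ ε * A / (24 * P.card) := fun x => by
        rw [le_div_iff₀ (by positivity)]
        exact hst x
      set η := ε * A / (24 * P.card) with hη'
      have hη0 : 0 ≤ η := by positivity
      have hηn : P.card * η = ε * A / 24 := by
        rw [hη']
        field_simp
      have hex : ∀ i, |excess pt c p s i - excess pt c p t i| ≤ 2 * η := fun i => by
        have a1 := abs_le.1 (hη (node pt c i))
        have a2 := abs_le.1 (hη c)
        unfold excess
        rw [abs_le]
        constructor <;> linarith
      have h2 : |Φ - ∑ i ∈ Finset.range P.card, excess pt c p t i| ≤ P.card * (2 * η) := by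
        rw [hΦ, ← Finset.sum_sub_distrib]
        refine (Finset.abs_sum_le_sum_abs _ _).trans
          ((Finset.sum_le_sum fun i _ => hex i).trans (by simp))
      have h3 : |W - weightedSum P.card σ.real (excess pt c p t)| ≤ w * (2 * η) := by
        rw [hW, hw']
        unfold weightedSum
        rw [← Finset.sum_sub_distrib, Finset.sum_mul]
        refine (Finset.abs_sum_le_sum_abs _ _).trans (Finset.sum_le_sum fun i hi => ?_)
        rw [← mul_sub, abs_mul, abs_of_nonneg (hw i (Finset.mem_range.1 hi)), mul_one]
        exact mul_le_mul_of_nonneg_left (hex i) (hw i (Finset.mem_range.1 hi))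
      have h4 : w * (2 * η) ≤ 2 * P.card * (2 * η) := by gcongr
      have h2' := abs_le.1 h2
      have h3' := abs_le.1 h3
      have h5 : 0 ≤ ε * costWS p P (fun _ => 1) s := by positivity
      rw [abs_le]
      -- Passing from s to t costs εA/12 for Φ and εA/6 for W; with εA/4 for the sampling error at t
      -- this makes εA/2.
      constructor <;> nlinarith
    · push Not at hfar
      -- Far away, 3A ≤ (ε/2)·n·r, and n·r ≤ cost(P, s) + A by `hnr`.
      have h1 : |Φ - W| ≤ 3 * A := (abs_sub _ _).trans (by linarith)
      nlinarith
  rw [hcostP] at hmain hnr ⊢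
  have e : Φ + P.card * r - (W + w * r) = (Φ - W) - (w - P.card) * r := by ring
  rw [e]
  refine (abs_sub _ _).trans ?_
  have h1 := mul_le_mul_of_nonneg_left hnr hε.le
  have h2 : 0 ≤ ε * (P.card * r) := by positivity
  linarith

theorem isCoreset_of_weights_one {ε : ℝ} (hε : 0 < ε) {σ : State}
    (hσ : ∀ i < P.card, σ.real 1 i = 1) :
    IsCoreset p ε (costWS p P (fun _ => 1) c) P (outSet pt σ) (outWeight pt σ) := by
  refine ⟨isWeightedSubset_outSet pt fun i hi => by rw [hσ i hi]; exact zero_le_one, fun s => ?_⟩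
  have e : costWS p P (fun _ => 1) s = costWS p (outSet pt σ) (outWeight pt σ) s := by
    rw [costWS_outSet pt c, costWS_one pt c]
    unfold weightedSum
    refine Finset.sum_congr rfl fun i hi => ?_
    rw [hσ i (Finset.mem_range.1 hi), one_mul]
  rw [← e, sub_self, abs_zero]
  exact mul_nonneg hε.le (add_nonneg (costWS_nonneg p s) (costWS_nonneg p c))

end Indexed

/-! ### The probability of failure -/

section Failure

open scoped ENNReal

variable {d ℓ : ℕ} {p ε δ : ℝ} {P : Finset (Fin ℓ → EuclideanSpace ℝ (Fin d))}

theorem exists_coreset_net (hp : 1 ≤ p) (hε : 0 < ε) (hε1 : ε < 1) (hP : P.Nonempty)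
    (c : Fin ℓ → EuclideanSpace ℝ (Fin d)) {A : ℝ} (hA : 0 ≤ A) :
    ∃ N : Finset (Fin ℓ → EuclideanSpace ℝ (Fin d)),
      (N.card : ℝ) ≤ (289 / ε ^ 2) ^ (d * ℓ) ∧
      ∀ s, dWS p c s * (ε * P.card) < 6 * A →
        ∃ t ∈ N, ∀ x, |dWS p x s - dWS p x t| * (24 * P.card) ≤ ε * A := by
  have hn : (0 : ℝ) < P.card := by exact_mod_cast hP.card_pos
  rcases hA.eq_or_lt with rfl | hA
  -- For A = 0 the strict inequality has no solution s, and the mesh below would be 0.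
  · refine ⟨∅, by simp; positivity, fun s hs => absurd hs ?_⟩
    have := dWS_nonneg (p := p) c s
    rw [mul_zero, not_lt]
    positivity
  · obtain ⟨N, hN, hcov⟩ := exists_dWS_net (R := 6 * A / (ε * P.card))
      (η := ε * A / (24 * P.card)) hp (by positivity) (by positivity) c
    refine ⟨N, hN.trans ?_, fun s hs => ?_⟩
    · gcongr
      -- Both A and |P| cancel, so the net size depends on ε, d and ℓ only; the summand 1 is
      -- absorbed by ε < 1.
      have e : 2 * (6 * A / (ε * P.card)) / (ε * A / (24 * P.card)) = 288 / ε ^ 2 := by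
        field_simp
        norm_num
      rw [e, le_div_iff₀ (by positivity), add_mul, div_mul_cancel₀ _ (by positivity)]
      have := pow_le_one₀ (n := 2) hε.le hε1.le
      linarith
    · obtain ⟨t, ht, h⟩ := hcov s (by rw [le_div_iff₀ (by positivity)]; exact hs.le)
      exact ⟨t, ht, fun x => by rw [← le_div_iff₀ (by positivity)]; exact h x⟩

/-! ### Two-sided tails and the union bound over the net. -/

theorem sampling_two_sided {D : ℕ → ℕ → ℝ} {T n m M : ℕ} {o k : ℕ → ℕ} {a : ℕ → ℝ}
    (h : IsSlots n M o k a) (hn : 0 < n) (hm : 0 < m) {φ : ℕ → ℝ} {B η : ℝ} (hη : 0 < η)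
    (hφ : ∀ i < n, M * |φ i| ≤ B * k i) (σ : State) (hσ : Sampler m M o k σ.nat σ.real)
    (hσ1 : σ.real 1 = 0) :
    (sampling.run D T σ).toOuterMeasure
        {τ | η * B < |weightedSum n τ.real φ - ∑ i ∈ Finset.range n, φ i|} ≤
      ENNReal.ofReal (2 * Real.exp (-(m * η ^ 2 / 8))) := by
  have h1 := sampling_tail (D := D) (T := T) h hn hm hη hφ σ hσ hσ1
  have h2 := sampling_tail (D := D) (T := T) h hn hm (φ := fun i => -1 * φ i) hη
    (fun i hi => by rw [neg_one_mul, abs_neg]; exact hφ i hi) σ hσ hσ1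
  simp only [weightedSum_const_mul, ← Finset.mul_sum] at h2
  rw [two_mul, ENNReal.ofReal_add (Real.exp_pos _).le (Real.exp_pos _).le]
  refine le_trans (MeasureTheory.measure_mono fun τ hτ => ?_)
    ((MeasureTheory.measure_union_le _ _).trans (add_le_add h1 h2))
  simp only [Set.mem_ofPred_eq, Set.mem_union] at hτ ⊢
  rcases lt_abs.1 hτ with h3 | h3
  · left; linarith
  · right; linarith

theorem sampling_failure_le (hd : 1 ≤ d) (hℓ : 1 ≤ ℓ) (hp : 1 ≤ p) (hε : 0 < ε) (hε1 : ε < 1)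
    (hδ : 0 < δ) (hP : P.Nonempty) (pt : Fin P.card ≃ P) (c : Fin ℓ → EuclideanSpace ℝ (Fin d))
    {T m M : ℕ} {o k : ℕ → ℕ} {L₁ L₂ : ℝ} (h₁ : IsLog P.card ε L₁) (h₂ : IsLog P.card δ L₂)
    (hm : IsRounded P.card (512 / (ε * ε) * (d * ℓ * (8 + (L₁ + L₁)) + L₂)) m) (hmn : m < P.card)
    (h : IsSlots P.card M o k (fun i => oracle p P pt c i P.card)) (ρ : State)
    (hρ : Sampler m M o k ρ.nat ρ.real) (hρ1 : ρ.real 1 = 0) :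
    (sampling.run (oracle p P pt c) T ρ).toOuterMeasure
      {σ | IsCoreset p ε (costWS p P (fun _ => 1) c) P (outSet pt σ) (outWeight pt σ)}ᶜ ≤
        ENNReal.ofReal δ := by
  have hn := hP.card_pos
  have ha : ∀ i, oracle p P pt c i P.card = dWS p (node pt c i) c := fun i => by
    have : node pt c P.card = c := by simp [node]
    change dWS p (node pt c i) (node pt c P.card) = _
    rw [this]
  simp only [ha] at h
  set A := costWS p P (fun _ => 1) c with hA
  have hA' : ∑ j ∈ Finset.range P.card, dWS p (node pt c j) c = A := (costWS_one pt c c).symm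
  have hbound := h.bound
  rw [hA'] at hbound
  have hbound1 : ∀ i < P.card, (M : ℝ) * |(1 : ℝ)| ≤ 2 * P.card * k i := fun i hi => by
    have h1 : (1 : ℝ) ≤ k i := by exact_mod_cast h.pos i hi
    have h2 : (M : ℝ) ≤ 2 * P.card := by exact_mod_cast h.le
    rw [abs_one, mul_one]
    exact h2.trans (le_mul_of_one_le_right (by positivity) h1)
  have hm0 : 0 < m := by
    have hx := hm.1.resolve_left hmn.ne
    have h1 := h₁.nonneg
    have h2 := h₂.nonneg
    have hd' : (1 : ℝ) ≤ d := by exact_mod_cast hd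
    have hℓ' : (1 : ℝ) ≤ ℓ := by exact_mod_cast hℓ
    have : (0 : ℝ) < m := lt_of_lt_of_le (by positivity) hx
    exact_mod_cast this
  have hm' : (m : ℝ) ≠ 0 := by exact_mod_cast hm0.ne'
  obtain ⟨N, hNcard, hN⟩ := exists_coreset_net hp hε hε1 hP c (A := A) (costWS_nonneg p c)
  set e := Real.exp (-(m * (ε / 8) ^ 2 / 8))
  have htotal := sampling_two_sided (D := oracle p P pt c) (T := T) h hn hm0
    (φ := fun _ => 1) (η := ε / 8) (by positivity) hbound1 ρ hρ hρ1
  have hnet := fun t => sampling_two_sided (D := oracle p P pt c) (T := T) h hn hm0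
    (φ := excess pt c p t) (B := 2 * A) (η := ε / 8) (by positivity) (fun i hi =>
      (mul_le_mul_of_nonneg_left (abs_excess_le pt c hp t i) (Nat.cast_nonneg M)).trans
        (hbound i hi)) ρ hρ hρ1
  -- With B = 2n for the count and B = 2A for the excess, the deviation (ε/8)·B is the ε/4 required
  -- by `isCoreset_of_net`.
  set V : (ℕ → ℝ) → ℝ → Set State := fun φ B =>
    {τ | ε / 8 * B < |weightedSum P.card τ.real φ - ∑ i ∈ Finset.range P.card, φ i|} with hV
  have hsub : (sampling.run (oracle p P pt c) T ρ).toOuterMeasure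
      {σ | IsCoreset p ε A P (outSet pt σ) (outWeight pt σ)}ᶜ ≤
      (sampling.run (oracle p P pt c) T ρ).toOuterMeasure
        (V (fun _ => 1) (2 * P.card) ∪ ⋃ t ∈ N, V (excess pt c p t) (2 * A)) := by
    refine toOuterMeasure_le_of_support fun τ hτ hbad => ?_
    by_contra hcon
    apply hbad
    simp only [hV, Set.mem_union, Set.mem_iUnion, Set.mem_ofPred_eq, not_or, not_exists, not_lt]
      at hcon
    obtain ⟨hc1, hc2⟩ := hcon
    have hs := (sampling_triple h hn ρ ⟨hρ, hρ1⟩ τ hτ).1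
    have hs1 := hs.sum (fun _ => 1) (2 * P.card) (fun i hi => by
      have := hbound1 i hi
      rwa [abs_one] at this)
    have hs2 := hs.sum (fun i => dWS p (node pt c i) c) (2 * A) hbound
    rw [mul_div_cancel₀ _ hm'] at hs1 hs2
    simp only [Finset.sum_const, Finset.card_range, nsmul_eq_mul, mul_one] at hc1
    refine isCoreset_of_net pt c hp hε hε1 hP hs.nonneg hA hN hs1 hs2 (hc1.trans (le_of_eq ?_))
      (fun t ht => (hc2 t ht).trans (le_of_eq ?_)) <;> ring
  refine hsub.trans ((MeasureTheory.measure_union_le _ _).trans ?_)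
  refine (add_le_add htotal ((MeasureTheory.measure_biUnion_finset_le N _).trans
    (Finset.sum_le_sum fun t _ => hnet t))).trans ?_
  rw [Finset.sum_const, nsmul_eq_mul, ← ENNReal.ofReal_natCast, ← ENNReal.ofReal_mul (by positivity),
    ← ENNReal.ofReal_add (by positivity) (by positivity)]
  refine ENNReal.ofReal_le_ofReal (le_trans (le_of_eq ?_)
    (failure_le hd hℓ hε hε1 hδ h₁ h₂ hm hmn hNcard))
  ring

end Failure

end Barycenter
end

/-! ### The main theorem. -/

open Barycenter in
theorem theorem5p9 :
    ∃ (A : Prog) (C : ℝ) (k : ℕ),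
      ∀ (d ℓ : ℕ), 1 ≤ d → 1 ≤ ℓ →
      ∀ (p ε δ : ℝ), 1 ≤ p → 0 < ε → ε < 1 → 0 < δ → δ < 1 →
      ∀ (P : Finset (Fin ℓ → EuclideanSpace ℝ (Fin d))), P.Nonempty →
      ∀ (pt : Fin P.card ≃ P) (c : Fin ℓ → EuclideanSpace ℝ (Fin d)) (T : ℕ), 1 ≤ T →
        (∀ σ ∈ (A.run (oracle p P pt c) T (input P.card d ℓ p ε δ)).support,
          IsWeightedSubset P (outSet pt σ) (outWeight pt σ) ∧
          ((outSet pt σ).card : ℝ) ≤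
            softBound C k (ε⁻¹ ^ 2 * d * ℓ) * (1 + Real.log (1 / δ)) ∧
          (σ.time : ℝ) ≤ softBound C k (P.card * T)) ∧
        ENNReal.ofReal (1 - δ) ≤
          (A.run (oracle p P pt c) T (input P.card d ℓ p ε δ)).toOuterMeasure
            {σ | IsCoreset p ε (costWS p P (fun _ => 1) c) P
              (outSet pt σ) (outWeight pt σ)} := by
  refine ⟨coresetProg, 6144, 1, fun d ℓ hd hℓ p ε δ hp hε hε1 hδ hδ1 P hP pt c T hT => ?_⟩
  have hD : ∀ i < P.card, 0 ≤ oracle p P pt c i P.card := fun i _ => dWS_nonneg _ _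
  have hn := hP.card_pos
  refine ⟨fun σ hσ => ?_, ?_⟩
  · obtain ⟨⟨h0, m, L₁, L₂, hL₁, hL₂, hm, hcard⟩, ht⟩ :=
      coresetProg_triple hn hD (input P.card d ℓ p ε δ) ⟨rfl, rfl⟩ σ hσ
    refine ⟨isWeightedSubset_outSet pt h0, ?_, ?_⟩
    · rw [card_outSet pt c]
      exact (Nat.cast_le.2 hcard).trans (sampleCount_le hd hℓ hε hε1 hδ hδ1 hL₁ hL₂ hm)
    · have h1 : 1 ≤ P.card * T := Nat.mul_pos hn hT
      -- The constant is dictated by the sample size; as |P|, T ≥ 1, the time alone needs only 1 +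
      -- 216 + 89 = 306.
      have h2 : σ.time ≤ 6144 * (P.card * T) := by
        have : P.card ≤ P.card * T := Nat.le_mul_of_pos_right _ hT
        simp only [input, zero_add] at ht
        rw [mul_add] at ht
        omega
      have h3 : (1 : ℝ) ≤ P.card * T := by exact_mod_cast h1
      have h4 : (σ.time : ℝ) ≤ 6144 * (P.card * T) := by exact_mod_cast h2
      refine h4.trans ?_
      rw [softBound, pow_one]
      exact le_mul_of_one_le_right (by positivity) (by linarith [Real.log_nonneg h3])
  · refine le_toOuterMeasure_of_compl hδ.le (coresetProg_toOuterMeasure_le hD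
      (fun τ hτ => ?_) fun m M o k L₁ L₂ hL₁ hL₂ hm hmn hslots ρ hρ hρ1 => ?_)
    · rw [Set.mem_compl_iff, not_not]
      exact isCoreset_of_weights_one pt c hε hτ
    · exact sampling_failure_le hd hℓ hp hε hε1 hδ hP pt c hL₁ hL₂ hm hmn hslots ρ hρ hρ1
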